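/- **Theorem (Mellin transform of $F_{p,q}^{\lambda;\sigma,\tau}$).** For $\lambda>0$ let $E_\lambda(x)=\sum_{n\ge 0}\frac{x^n}{\Gamma(\lambda n+1)}$ be the Mittag-Leffler function, let $B(a,b)=\int_0^1t^{a-1}(1-t)^{b-1}\,dt$ be the classical beta function, and put $$B_{p,q}^{\lambda;\sigma,\tau}(a,b)=\int_0^1 t^{a-1}(1-t)^{b-1}\,E_\lambda\!\left(-\frac{p}{t^{\sigma}}\right)E_\lambda\!\left(-\frac{q}{(1-t)^{\tau}}\right)dt ,$$ $$F_{p,q}^{\lambda;\sigma,\tau}(\eta_1,\eta_2;\eta_3;z)=\sum_{n=0}^\infty(\eta_1)_n\,\frac{B_{p,q}^{\lambda;\sigma,\tau}(\eta_2+n,\eta_3-\eta_2)}{B(\eta_2,\eta_3-\eta_2)}\,\frac{z^n}{n!}.$$ Let $0<\lambda<2$ and $\sigma,\tau>0$ be real, and let $\eta_1,\eta_2,\eta_3,z,r,s\in\mathbb C$ with $\Re(\eta_3)>\Re(\eta_2)>0$, $|z|<1$, $\Re(r)>0$, $\Re(s)>0$ and $\sin(\pi r)\sin(\pi s)\ne0$;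 if $\lambda\neq1$, assume moreover $\Re(r)<1$ and $\Re(s)<1$. Then, for all real $p,q\ge0$, the integrals and the series defining $F_{p,q}^{\lambda;\sigma,\tau}(\eta_1,\eta_2;\eta_3;z)$ converge absolutely, the double Mellin integral below converges absolutely, and $$\int_0^\infty\!\!\int_0^\infty p^{r-1}q^{s-1}\,F_{p,q}^{\lambda;\sigma,\tau}(\eta_1,\eta_2;\eta_3;z)\,dp\,dq =\frac{\pi^2}{\sin(\pi r)\,\sin(\pi s)\,\Gamma(1-r\lambda)\,\Gamma(1-s\lambda)}\;\frac{B(\eta_2+\sigma r,\;\eta_3+\tau s-\eta_2)}{B(\eta_2,\eta_3-\eta_2)}\;{}_2F_1(\eta_1,\eta_2+\sigma r;\eta_3+\sigma r+\tau s;z),$$ where ${}_2F_1$ is the Gauss hypergeometric function and $1/\Gamma$ is read as $0$ at the poles of $\Gamma$. -/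

import Mathlib

open MeasureTheory Set

/-- The Mittag-Leffler function `E_lam(x) = ∑ xⁿ / Γ(lam n + 1)`. -/
noncomputable def mittagLeffler (lam : ℝ) (x : ℂ) : ℂ :=
  ∑' n : ℕ, x ^ n / Complex.Gamma ((lam : ℂ) * (n : ℂ) + 1)

/-- The integrand
`t^(a-1) (1-t)^(b-1) E_lam(-p / t^σ) E_lam(-q / (1-t)^τ)` of the extended beta function. -/
noncomputable def extBetaIntegrand (lam σ τ : ℝ) (p q a b : ℂ) (t : ℝ) : ℂ :=
  (t : ℂ) ^ (a - 1) * (1 - (t : ℂ)) ^ (b - 1)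
    * mittagLeffler lam (-(p / ((t ^ σ : ℝ) : ℂ)))
    * mittagLeffler lam (-(q / (((1 - t) ^ τ : ℝ) : ℂ)))

/-- The extended beta function `B_{p,q}^{lam;σ,τ}(a, b)`. -/
noncomputable def extBeta (lam σ τ : ℝ) (p q a b : ℂ) : ℂ :=
  ∫ t in (0 : ℝ)..1, extBetaIntegrand lam σ τ p q a b t

/-- The `n`-th term of the series that defines the extended hypergeometric function:
`(η₁)_n · B_{p,q}^{lam;σ,τ}(η₂ + n, η₃ - η₂) / B(η₂, η₃ - η₂) · zⁿ / n!`. -/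
noncomputable def extHypergeometricTerm (lam σ τ : ℝ) (p q η₁ η₂ η₃ z : ℂ) (n : ℕ) : ℂ :=
  (ascPochhammer ℂ n).eval η₁
    * (extBeta lam σ τ p q (η₂ + n) (η₃ - η₂) / Complex.betaIntegral η₂ (η₃ - η₂))
    * (z ^ n / (n.factorial : ℂ))

/-- The extended hypergeometric function `F_{p,q}^{lam;σ,τ}(η₁, η₂; η₃; z)`. -/
noncomputable def extHypergeometric (lam σ τ : ℝ) (p q η₁ η₂ η₃ z : ℂ) : ℂ :=
  ∑' n : ℕ, extHypergeometricTerm lam σ τ p q η₁ η₂ η₃ z n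

/-- Absolute convergence of the double Mellin integral of `f` at `(r, s)`. -/
def DoubleMellinConvergent (f : ℝ → ℝ → ℂ) (r s : ℂ) : Prop :=
  IntegrableOn (fun x : ℝ × ℝ => (x.1 : ℂ) ^ (r - 1) * (x.2 : ℂ) ^ (s - 1) * f x.1 x.2)
    (Ioi 0 ×ˢ Ioi 0)

/-- The double Mellin transform
`∫₀^∞ ∫₀^∞ p^(r-1) q^(s-1) f(p, q) dp dq`. -/
noncomputable def doubleMellin (f : ℝ → ℝ → ℂ) (r s : ℂ) : ℂ :=
  ∫ q in Ioi (0 : ℝ), ∫ p in Ioi (0 : ℝ), (p : ℂ) ^ (r - 1) * (q : ℂ) ^ (s - 1) * f p q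

open Filter Topology

/-! For `0 < t < 1`, sum the binomial series `∑ (η₁)_n (zt)ⁿ/n!` under the beta integral: this
writes `F` as a single integral over `t` (`hasSum_extHypergeometricTerm`). By Fubini the integrals
in `p` and `q` may be done first. The dilations `p = t^σ x` and `q = (1-t)^τ y` turn them into the
Mellin transforms of `E_λ(-x)` at `r` and `s`, times `t^(σr) (1-t)^(τs)`. What remains is Euler's
integral for `₂F₁` with shifted parameters (`integral_binomialSum_mul_beta`).

The analytic core is therefore the Mellin transform `π / (sin(πw) Γ(1-λw))` of `E_λ(-x)` on `0 < Re
w < 1`. Hankel's formula for `1/Γ`, inserted into the power series, represents `E_λ(-x)` by the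
integral of `e^s s^(λ-1)/(s^λ+x)` over a Hankel contour. For `λ < 2` the contour can be taken with
opening angle `θ > π/2` and `λθ < π`. Then `e^s` decays along the rays, and no zero of `s^λ+x`
obstructs shrinking the arc to the origin (`mittagLeffler_neg_eq_integral`). Integrating over `x` on
the two rays leaves a Stieltjes integral, worth `π/sin(πw)` times a power of `s`, and then Gamma
integrals along the rays, whose difference is `2πi/Γ(1-λw)`. All contours are written in the
coordinate `s = e^w`, so that rays become horizontal lines and no branch of the logarithm is needed.

For `λ = 1` the function is `e^(-x)` and its transform is the Gamma integral on all of `Re w > 0`.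
The same representation on rays bounds `E_λ(-x)` for large `x`, which makes the beta integrals
converge. -/

/-! ### Logarithmic coordinates and contour shifts in strips. -/

theorem integrable_comp_exp {E : Type*} [NormedAddCommGroup E] [NormedSpace ℝ E] (g : ℝ → E) :
    Integrable (fun u : ℝ => Real.exp u • g (Real.exp u)) ↔ IntegrableOn g (Ioi 0) := by
  have := integrableOn_image_iff_integrableOn_abs_deriv_smul (s := univ) MeasurableSet.univ
    (fun x _ => (Real.hasDerivAt_exp x).hasDerivWithinAt) Real.exp_injective.injOn g
  simp only [image_univ, Real.range_exp, Real.abs_exp, integrableOn_univ] at this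
  exact this.symm

theorem integral_comp_exp {E : Type*} [NormedAddCommGroup E] [NormedSpace ℝ E] (g : ℝ → E) :
    ∫ u : ℝ, Real.exp u • g (Real.exp u) = ∫ x in Ioi (0 : ℝ), g x := by
  have := integral_image_eq_integral_abs_deriv_smul (s := univ) MeasurableSet.univ
    (fun x _ => (Real.hasDerivAt_exp x).hasDerivWithinAt) Real.exp_injective.injOn g
  simp only [image_univ, Real.range_exp, Real.abs_exp, Measure.restrict_univ] at this
  exact this.symm

theorem continuous_comp_horizontal {f : ℂ → ℂ} {s : Set ℝ}
    (H : ContinuousOn f {w | w.im ∈ s}) {v : ℝ} (hv : v ∈ s) :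
    Continuous fun u : ℝ => f (u + v * Complex.I) :=
  H.comp_continuous (by fun_prop) fun u => by simpa using hv

theorem tendsto_integral_vertical_zero {f : ℂ → ℂ} {g : ℝ → ℝ} {α β : ℝ} {l : Filter ℝ}
    (hb : ∀ᶠ u : ℝ in l, ∀ v ∈ uIcc α β, ‖f (u + v * Complex.I)‖ ≤ g u)
    (hg : Tendsto g l (𝓝 0)) :
    Tendsto (fun u : ℝ => ∫ v in α..β, f (u + v * Complex.I)) l (𝓝 0) := by
  refine squeeze_zero_norm' (a := fun u => g u * |β - α|) ?_ (by simpa using hg.mul_const |β - α|)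
  filter_upwards [hb] with u hu
  exact intervalIntegral.norm_integral_le_of_norm_le_const
    fun v hv => hu v (uIoc_subset_uIcc hv)

theorem integral_rect_eq {f : ℂ → ℂ} {s : Set ℂ} (H : DifferentiableOn ℂ f s) {a b α β : ℝ}
    (hs : uIcc a b ×ℂ uIcc α β ⊆ s) :
    (∫ u in a..b, f (u + β * Complex.I)) - (∫ u in a..b, f (u + α * Complex.I)) =
      Complex.I * (∫ v in α..β, f (b + v * Complex.I))
        - Complex.I * (∫ v in α..β, f (a + v * Complex.I)) := by
  have := Complex.integral_boundary_rect_eq_zero_of_differentiableOn f ⟨a, α⟩ ⟨b, β⟩ (H.mono hs)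
  simp only [smul_eq_mul] at this
  linear_combination -this

/-- The integral of a holomorphic function along the horizontal lines of a strip does not depend
on the line. -/
theorem integral_horizontal_eq {f : ℂ → ℂ} {g : ℝ → ℝ} {s : Set ℝ} (hs : s.OrdConnected)
    (H : DifferentiableOn ℂ f {w | w.im ∈ s})
    (hb : ∀ u : ℝ, ∀ v ∈ s, ‖f (u + v * Complex.I)‖ ≤ g u) (hg : Integrable g)
    (hbot : Tendsto g atBot (𝓝 0)) (htop : Tendsto g atTop (𝓝 0)) {α β : ℝ}
    (hα : α ∈ s) (hβ : β ∈ s) :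
    ∫ u : ℝ, f (u + β * Complex.I) = ∫ u : ℝ, f (u + α * Complex.I) := by
  have hsub : uIcc α β ⊆ s := hs.uIcc_subset hα hβ
  have hint : ∀ v ∈ s, Integrable fun u : ℝ => f (u + v * Complex.I) := fun v hv =>
    hg.mono' (continuous_comp_horizontal H.continuousOn hv).aestronglyMeasurable
      (ae_of_all _ fun u => hb u v hv)
  have hrect : ∀ t : ℝ, _ := fun t => integral_rect_eq H (a := -t) (b := t) (α := α) (β := β)
    fun w hw => hsub hw.2
  have h1 := (intervalIntegral_tendsto_integral (hint β hβ) tendsto_neg_atTop_atBot tendsto_id).sub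
    (intervalIntegral_tendsto_integral (hint α hα) tendsto_neg_atTop_atBot tendsto_id)
  have hv : ∀ {l : Filter ℝ}, Tendsto g l (𝓝 0) →
      Tendsto (fun u : ℝ => Complex.I * ∫ v in α..β, f (u + v * Complex.I)) l (𝓝 0) := by
    intro l hl
    simpa using (tendsto_integral_vertical_zero
      (Eventually.of_forall fun u v hv => hb u v (hsub hv)) hl).const_mul Complex.I
  have h2 := (hv htop).sub ((hv hbot).comp tendsto_neg_atTop_atBot)
  simp only [sub_zero] at h2
  refine sub_eq_zero.mp (tendsto_nhds_unique h1 (h2.congr fun t => ?_))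
  simpa using (hrect t).symm

/-- Closing a half strip on the left. -/
theorem integral_halfStrip_eq {f : ℂ → ℂ} {C κ L α β : ℝ} (hκ : 0 < κ) (hαβ : α ≤ β)
    (H : DifferentiableOn ℂ f {w | w.re ≤ L ∧ w.im ∈ Icc α β})
    (hb : ∀ u ≤ L, ∀ v ∈ Icc α β, ‖f (u + v * Complex.I)‖ ≤ C * Real.exp (κ * u)) :
    (∀ v ∈ Icc α β, IntegrableOn (fun u : ℝ => f (u + v * Complex.I)) (Iic L)) ∧
    (∫ u in Iic L, f (u + β * Complex.I)) - (∫ u in Iic L, f (u + α * Complex.I)) =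
      Complex.I * ∫ v in α..β, f (L + v * Complex.I) := by
  have hg : IntegrableOn (fun u => C * Real.exp (κ * u)) (Iic L) := by
    have := integrableOn_exp_mul_Iic hκ L
    exact this.const_mul C
  have hint : ∀ v ∈ Icc α β, IntegrableOn (fun u : ℝ => f (u + v * Complex.I)) (Iic L) := by
    intro v hv
    refine Integrable.mono' hg (ContinuousOn.aestronglyMeasurable ?_ measurableSet_Iic)
      ((ae_restrict_mem measurableSet_Iic).mono fun u hu => hb u hu v hv)
    exact H.continuousOn.comp (by fun_prop) fun u hu => by
      constructor <;> simpa using ‹_›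
  refine ⟨hint, ?_⟩
  have h1 := (intervalIntegral_tendsto_integral_Iic L (hint β (right_mem_Icc.2 hαβ))
    tendsto_id).sub (intervalIntegral_tendsto_integral_Iic L (hint α (left_mem_Icc.2 hαβ))
    tendsto_id)
  have hv : Tendsto (fun u : ℝ => ∫ v in α..β, f (u + v * Complex.I)) atBot (𝓝 0) := by
    refine tendsto_integral_vertical_zero (g := fun u => C * Real.exp (κ * u)) ?_ ?_
    · filter_upwards [eventually_le_atBot L] with u hu v hv
      exact hb u hu v (by rwa [uIcc_of_le hαβ] at hv)
    · simpa using (Real.tendsto_exp_atBot.comp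
        (tendsto_id.const_mul_atBot hκ)).const_mul C
  have h2 := (hv.const_mul Complex.I).const_sub (Complex.I * ∫ v in α..β, f (L + v * Complex.I))
  rw [mul_zero, sub_zero] at h2
  refine tendsto_nhds_unique h1 (h2.congr' ?_)
  filter_upwards [eventually_le_atBot L] with t ht
  refine (integral_rect_eq H fun w hw => ?_).symm
  obtain ⟨h1, h2⟩ := hw
  rw [uIcc_of_le ht] at h1
  rw [uIcc_of_le hαβ] at h2
  exact ⟨h1.2, h2⟩

/-! ### Gamma integrals along rays. -/

theorem integrable_exp_neg_mul_exp_mul {c κ : ℝ} (hc : 0 < c) (hκ : 0 < κ) :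
    Integrable fun u : ℝ => Real.exp (-c * Real.exp u) * Real.exp (κ * u) := by
  have h := (integrable_comp_exp (fun x : ℝ => x ^ (κ - 1) * Real.exp (-c * x ^ (1 : ℝ)))).2
    (integrableOn_rpow_mul_exp_neg_mul_rpow (by linarith) one_pos hc)
  refine h.congr (ae_of_all _ fun u => ?_)
  simp only [smul_eq_mul, Real.rpow_one]
  rw [← Real.exp_mul, ← mul_assoc, ← Real.exp_add, mul_comm]
  ring_nf

theorem tendsto_exp_neg_mul_exp_mul_atBot {c κ : ℝ} (hc : 0 < c) (hκ : 0 < κ) :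
    Tendsto (fun u : ℝ => Real.exp (-c * Real.exp u) * Real.exp (κ * u)) atBot (𝓝 0) := by
  refine squeeze_zero (fun u => by positivity) (fun u => ?_)
    (Real.tendsto_exp_atBot.comp (tendsto_id.const_mul_atBot hκ))
  have : Real.exp (-c * Real.exp u) ≤ 1 := Real.exp_le_one_iff.2 (by
    have := Real.exp_pos u; nlinarith)
  simpa using mul_le_mul_of_nonneg_right this (Real.exp_pos (κ * u)).le

theorem tendsto_exp_neg_mul_exp_mul_atTop {c : ℝ} (κ : ℝ) (hc : 0 < c) :
    Tendsto (fun u : ℝ => Real.exp (-c * Real.exp u) * Real.exp (κ * u)) atTop (𝓝 0) := by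
  refine ((tendsto_rpow_mul_exp_neg_mul_atTop_nhds_zero κ c hc).comp
    Real.tendsto_exp_atTop).congr fun u => ?_
  simp only [Function.comp]
  rw [← Real.exp_mul, mul_comm, mul_comm u]

theorem ofReal_exp_cpow (u : ℝ) (b : ℂ) : ((Real.exp u : ℝ) : ℂ) ^ b = Complex.exp (b * u) := by
  rw [Complex.cpow_def_of_ne_zero (by exact_mod_cast (Real.exp_pos u).ne'), ← Complex.ofReal_log
    (Real.exp_pos u).le, Real.log_exp, mul_comm]

theorem norm_cexp_neg_cexp_le {u v ψ : ℝ} (hψ : ψ ≤ Real.pi) (hv : |v| ≤ ψ) :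
    ‖Complex.exp (-Complex.exp (u + v * Complex.I))‖ ≤
      Real.exp (-Real.cos ψ * Real.exp u) := by
  rw [Complex.norm_exp, Complex.neg_re, Complex.exp_re]
  simp only [Complex.add_re, Complex.ofReal_re, Complex.re_ofReal_mul, Complex.I_re, mul_zero,
    add_zero, Complex.add_im, Complex.ofReal_im, Complex.im_ofReal_mul, Complex.I_im, mul_one,
    zero_add]
  apply Real.exp_le_exp.2
  have : Real.cos ψ ≤ Real.cos v := by
    rw [← Real.cos_abs v]
    exact Real.cos_le_cos_of_nonneg_of_le_pi (abs_nonneg v) hψ hv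
  have := Real.exp_pos u
  nlinarith

theorem norm_cexp_mul_le {b : ℂ} {u v ψ : ℝ} (hv : |v| ≤ ψ) :
    ‖Complex.exp (b * (u + v * Complex.I))‖ ≤
      Real.exp (|b.im| * ψ) * Real.exp (b.re * u) := by
  rw [Complex.norm_exp, ← Real.exp_add]
  apply Real.exp_le_exp.2
  simp only [Complex.mul_re, Complex.add_re, Complex.ofReal_re,
    Complex.I_re, mul_zero, Complex.add_im, Complex.ofReal_im, Complex.im_ofReal_mul,
    Complex.I_im, mul_one, zero_add]
  have : -(b.im * v) ≤ |b.im| * |v| := by rw [← abs_mul]; exact neg_le_abs _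
  have := mul_le_mul_of_nonneg_left hv (abs_nonneg b.im)
  linarith

/-- The Gamma integral along a ray, in logarithmic coordinates. -/
theorem integral_cexp_neg_cexp {b : ℂ} (hb : 0 < b.re) {ψ : ℝ} (hψ : |ψ| < Real.pi / 2) :
    ∫ u : ℝ, Complex.exp (-Complex.exp (u + ψ * Complex.I))
      * Complex.exp (b * (u + ψ * Complex.I)) = Complex.Gamma b := by
  set f : ℂ → ℂ := fun w => Complex.exp (-Complex.exp w) * Complex.exp (b * w) with hf
  have hcos : 0 < Real.cos ψ := Real.cos_pos_of_mem_Ioo ⟨(abs_lt.1 hψ).1, (abs_lt.1 hψ).2⟩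
  have hg := (integrable_exp_neg_mul_exp_mul hcos hb).const_mul (Real.exp (|b.im| * |ψ|))
  have h := integral_horizontal_eq (f := f) (s := Icc (-|ψ|) |ψ|)
    (g := fun u => Real.exp (|b.im| * |ψ|) *
      (Real.exp (-Real.cos ψ * Real.exp u) * Real.exp (b.re * u))) ordConnected_Icc
    (Differentiable.differentiableOn (by fun_prop)) ?_ hg
    (by simpa using (tendsto_exp_neg_mul_exp_mul_atBot hcos hb).const_mul (Real.exp (|b.im| * |ψ|)))
    (by simpa using
      (tendsto_exp_neg_mul_exp_mul_atTop b.re hcos).const_mul (Real.exp (|b.im| * |ψ|)))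
    (α := 0) (β := ψ) (by simp) ⟨neg_abs_le ψ, le_abs_self ψ⟩
  · refine h.trans ?_
    rw [Complex.Gamma_eq_integral hb, Complex.GammaIntegral, ← integral_comp_exp]
    congr 1 with u
    simp only [hf, Complex.ofReal_zero, zero_mul, add_zero, ofReal_exp_cpow, Complex.real_smul]
    push_cast
    have h1 : Complex.exp (b * u) = Complex.exp u * Complex.exp ((b - 1) * u) := by
      rw [← Complex.exp_add]
      ring_nf
    rw [h1]
    ring
  · intro u v hv
    rw [hf]
    simp only [norm_mul]
    have hv' : |v| ≤ |ψ| := abs_le.2 hv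
    have h1 := norm_cexp_neg_cexp_le (u := u) (by linarith [Real.pi_pos]) hv'
    rw [Real.cos_abs] at h1
    have h2 := norm_cexp_mul_le (b := b) (u := u) hv'
    calc _ ≤ _ := mul_le_mul h1 h2 (norm_nonneg _) (Real.exp_pos _).le
      _ = _ := by ring

/-! ### The beta integral on the line and the Stieltjes kernel. -/

theorem integrable_mul_exp_sigmoid_iff (g : ℝ → ℂ) :
    Integrable (fun v : ℝ => (Real.sigmoid v * Real.sigmoid (-v)) • g (Real.sigmoid v)) ↔
      IntegrableOn g (Ioo 0 1) := by
  have := integrableOn_image_iff_integrableOn_abs_deriv_smul (s := univ) MeasurableSet.univ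
    (fun x _ => (Real.hasDerivAt_sigmoid x).hasDerivWithinAt) Real.sigmoid_injective.injOn g
  simp only [image_univ, Real.range_sigmoid, integrableOn_univ] at this
  rw [this]
  refine integrable_congr (ae_of_all _ fun v => ?_)
  simp only [← Real.sigmoid_neg]
  rw [abs_of_pos (mul_pos (Real.sigmoid_pos _) (Real.sigmoid_pos _))]

theorem integral_mul_exp_sigmoid (g : ℝ → ℂ) :
    ∫ v : ℝ, (Real.sigmoid v * Real.sigmoid (-v)) • g (Real.sigmoid v) = ∫ t in Ioo 0 1, g t := by
  have := integral_image_eq_integral_abs_deriv_smul (s := univ) MeasurableSet.univ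
    (fun x _ => (Real.hasDerivAt_sigmoid x).hasDerivWithinAt) Real.sigmoid_injective.injOn g
  simp only [image_univ, Real.range_sigmoid, Measure.restrict_univ] at this
  rw [this]
  congr 1 with v
  simp only [← Real.sigmoid_neg]
  rw [abs_of_pos (mul_pos (Real.sigmoid_pos _) (Real.sigmoid_pos _))]

/-- The substitution `t = e^v/(1+e^v)` carries the line onto `(0,1)`. Since the beta parameters `w`
and `1-w` add up to one, all powers of `1/(1+e^v)` combine to a single factor. -/
theorem sigmoid_beta_eq (w : ℂ) (v : ℝ) :
    (Real.sigmoid v * Real.sigmoid (-v)) •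
      ((Real.sigmoid v : ℂ) ^ (w - 1) * (1 - (Real.sigmoid v : ℂ)) ^ ((1 - w) - 1)) =
      Complex.exp (w * v) / (1 + Complex.exp v) := by
  have h0 := Real.sigmoid_pos (-v)
  have h1 : Real.sigmoid v = Real.sigmoid (-v) * Real.exp v := by
    have := Real.sigmoid_mul_rexp_neg (-v)
    simpa using this.symm
  have h2 : (1 - (Real.sigmoid v : ℂ)) = (Real.sigmoid (-v) : ℂ) := by
    rw [Real.sigmoid_neg]; push_cast; ring
  have h3 : (Real.sigmoid (-v) : ℂ) = 1 / (1 + Complex.exp v) := by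
    rw [Real.sigmoid_def]; push_cast; simp
  have hne : (Real.sigmoid (-v) : ℂ) ≠ 0 := by exact_mod_cast h0.ne'
  rw [h2, h1, Complex.ofReal_mul, Complex.mul_cpow_ofReal_nonneg h0.le (Real.exp_pos v).le,
    ofReal_exp_cpow, Complex.real_smul, div_eq_mul_one_div, ← h3]
  have h4 : (Real.sigmoid (-v) : ℂ) ^ (w - 1) * (Real.sigmoid (-v) : ℂ) ^ (1 - w - 1)
      * (Real.sigmoid (-v) : ℂ) = 1 := by
    rw [← Complex.cpow_add _ _ hne]
    ring_nf
    rw [Complex.cpow_neg_one, inv_mul_cancel₀ hne]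
  have h5 : Complex.exp (w * v) = Complex.exp v * Complex.exp ((w - 1) * v) := by
    rw [← Complex.exp_add]; ring_nf
  rw [h5]
  push_cast
  linear_combination (Real.sigmoid (-v) : ℂ) * Complex.exp v * Complex.exp ((w - 1) * v) * h4

theorem integrable_exp_mul_div_one_add_exp {w : ℂ} (h0 : 0 < w.re) (h1 : w.re < 1) :
    Integrable fun v : ℝ => Complex.exp (w * v) / (1 + Complex.exp v) := by
  simp_rw [← sigmoid_beta_eq]
  refine (integrable_mul_exp_sigmoid_iff
    fun t : ℝ => (t : ℂ) ^ (w - 1) * (1 - (t : ℂ)) ^ ((1 - w) - 1)).2 ?_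
  have := Complex.betaIntegral_convergent h0 (v := 1 - w) (by simpa using h1)
  rw [intervalIntegrable_iff_integrableOn_Ioc_of_le zero_le_one] at this
  exact this.mono_set Ioo_subset_Ioc_self

theorem integral_exp_mul_div_one_add_exp {w : ℂ} (h0 : 0 < w.re) (h1 : w.re < 1) :
    ∫ v : ℝ, Complex.exp (w * v) / (1 + Complex.exp v) = Real.pi / Complex.sin (Real.pi * w) := by
  simp_rw [← sigmoid_beta_eq]
  rw [integral_mul_exp_sigmoid
    fun t : ℝ => (t : ℂ) ^ (w - 1) * (1 - (t : ℂ)) ^ ((1 - w) - 1)]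
  have := Complex.Gamma_mul_Gamma_eq_betaIntegral h0 (t := 1 - w) (by simpa using h1)
  rw [Complex.Gamma_mul_Gamma_one_sub, add_sub_cancel, Complex.Gamma_one, one_mul,
    Complex.betaIntegral, intervalIntegral.integral_of_le zero_le_one,
    integral_Ioc_eq_integral_Ioo] at this
  exact this.symm

/-- With `a = e^u`, the squared norm is `a² + x² + 2ax cos v`. Replacing `cos v` by the smaller `cos
φ` and subtracting `cos²(φ/2)(a+x)²` leaves `(1 - cos φ)(a-x)²/2 ≥ 0`. The bound lets a real
denominator replace the complex one throughout. -/
theorem cos_half_mul_le_norm_cexp_add {u v x φ : ℝ} (hx : 0 ≤ x) (hφ : φ ≤ Real.pi)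
    (hv : |v| ≤ φ) :
    Real.cos (φ / 2) * (Real.exp u + x) ≤ ‖Complex.exp (u + v * Complex.I) + x‖ := by
  have hcos : Real.cos φ ≤ Real.cos v := by
    rw [← Real.cos_abs v]
    exact Real.cos_le_cos_of_nonneg_of_le_pi (abs_nonneg v) hφ hv
  refine le_of_sq_le_sq ?_ (norm_nonneg _)
  rw [Complex.sq_norm, Complex.normSq_apply, Complex.add_re, Complex.add_im, Complex.exp_re,
    Complex.exp_im]
  simp only [Complex.add_re, Complex.ofReal_re, Complex.re_ofReal_mul, Complex.I_re, mul_zero,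
    add_zero, Complex.add_im, Complex.ofReal_im, Complex.im_ofReal_mul, Complex.I_im, mul_one,
    zero_add]
  rw [mul_pow, Real.cos_sq, mul_div_cancel₀ _ (two_ne_zero)]
  have h1 := Real.sin_sq_add_cos_sq v
  have h2 := Real.cos_le_one φ
  have h3 := mul_nonneg (mul_nonneg (Real.exp_pos u).le hx) (sub_nonneg.2 hcos)
  have h4 := mul_nonneg (sub_nonneg.2 h2) (sq_nonneg (Real.exp u - x))
  have h5 : Real.exp u ^ 2 * (Real.sin v ^ 2 + Real.cos v ^ 2) = Real.exp u ^ 2 := by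
    rw [h1, mul_one]
  nlinarith

theorem cos_half_pos {φ : ℝ} (h0 : 0 ≤ φ) (h1 : φ < Real.pi) : 0 < Real.cos (φ / 2) :=
  Real.cos_pos_of_mem_Ioo ⟨by linarith [Real.pi_pos], by linarith⟩

theorem cexp_add_ofReal_ne_zero {u v x : ℝ} (hx : 0 ≤ x) (hv : |v| < Real.pi) :
    Complex.exp (u + v * Complex.I) + x ≠ 0 := by
  have h := cos_half_mul_le_norm_cexp_add (u := u) hx hv.le le_rfl
  have := mul_pos (cos_half_pos (abs_nonneg v) hv) (add_pos_of_pos_of_nonneg (Real.exp_pos u) hx)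
  exact norm_pos_iff.1 (this.trans_le h)

/-- The poles of `1/(1+e^z)` nearest to the real axis are `±πi`, so the line of integration may be
moved to any height below `π` in absolute value. -/
theorem integral_exp_mul_div_one_add_exp_horizontal {w : ℂ} (h0 : 0 < w.re) (h1 : w.re < 1)
    {φ : ℝ} (hφ : |φ| < Real.pi) :
    ∫ v : ℝ, Complex.exp (w * (v + φ * Complex.I)) / (1 + Complex.exp (v + φ * Complex.I)) =
      Real.pi / Complex.sin (Real.pi * w) := by
  set f : ℂ → ℂ := fun z => Complex.exp (w * z) / (1 + Complex.exp z) with hf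
  have hc := cos_half_pos (abs_nonneg φ) hφ
  set C := Real.exp (|w.im| * |φ|) / Real.cos (|φ| / 2) with hC
  have hnorm : ∀ v : ℝ, ‖Complex.exp (w * v) / (1 + Complex.exp v)‖ =
      Real.exp (w.re * v) / (1 + Real.exp v) := by
    intro v
    rw [norm_div, Complex.norm_exp, Complex.re_mul_ofReal]
    congr 1
    rw [← Complex.ofReal_exp, ← Complex.ofReal_one, ← Complex.ofReal_add, Complex.norm_real,
      Real.norm_of_nonneg (by positivity)]
  have hint : Integrable fun v : ℝ => C * (Real.exp (w.re * v) / (1 + Real.exp v)) := by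
    have := (integrable_exp_mul_div_one_add_exp h0 h1).norm
    simp_rw [hnorm] at this
    exact this.const_mul C
  have h := integral_horizontal_eq (f := f) (s := Icc (-|φ|) |φ|) ordConnected_Icc ?_ ?_ hint ?_ ?_
    (α := 0) (β := φ) (by simp) ⟨neg_abs_le φ, le_abs_self φ⟩
  · refine h.trans ?_
    rw [← integral_exp_mul_div_one_add_exp h0 h1]
    simp [hf]
  · intro z hz
    refine (DifferentiableAt.div (by fun_prop) (by fun_prop) ?_).differentiableWithinAt
    have := cexp_add_ofReal_ne_zero (u := z.re) (v := z.im) zero_le_one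
      ((abs_le.2 hz).trans_lt hφ)
    rw [Complex.re_add_im] at this
    rwa [add_comm, ← Complex.ofReal_one]
  · intro u v hv
    have hv' : |v| ≤ |φ| := abs_le.2 hv
    have e1 := norm_cexp_mul_le (b := w) (u := u) hv'
    have e2 := cos_half_mul_le_norm_cexp_add (u := u) zero_le_one hφ.le hv'
    simp only [hf, norm_div, hC]
    rw [div_mul_div_comm, add_comm (1 : ℂ), add_comm 1 (Real.exp u), ← Complex.ofReal_one]
    exact div_le_div₀ (by positivity) e1 (by positivity) e2
  · rw [← mul_zero C]
    refine Tendsto.const_mul C (squeeze_zero (fun v => by positivity) (fun v => ?_)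
      (Real.tendsto_exp_atBot.comp (tendsto_id.const_mul_atBot h0)))
    exact div_le_self (Real.exp_pos _).le (by linarith [Real.exp_pos v])
  · rw [← mul_zero C]
    refine Tendsto.const_mul C (squeeze_zero (fun v => by positivity) (fun v => ?_)
      (Real.tendsto_exp_atBot.comp (tendsto_id.const_mul_atTop_of_neg
        (r := w.re - 1) (by linarith))))
    rw [div_le_iff₀ (by positivity)]
    simp only [Function.comp, id]
    have : Real.exp (w.re * v) = Real.exp ((w.re - 1) * v) * Real.exp v := by
      rw [← Real.exp_add]; ring_nf
    rw [this]
    have := Real.exp_pos ((w.re - 1) * v)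
    nlinarith

/-- The Stieltjes-type Mellin transform `∫ x^(w-1) e^ζ / (e^ζ + x) dx`. -/
theorem integral_cpow_mul_cexp_div_cexp_add {w ζ : ℂ} (h0 : 0 < w.re) (h1 : w.re < 1)
    (hζ : |ζ.im| < Real.pi) :
    ∫ x in Ioi (0 : ℝ), (x : ℂ) ^ (w - 1) * (Complex.exp ζ / (Complex.exp ζ + x)) =
      Complex.exp (w * ζ) * (Real.pi / Complex.sin (Real.pi * w)) := by
  -- Writing `x = e^(ζ+y)` forces `Im y = -Im ζ`; together with a translation by `Re ζ` this
  -- extracts the factor `e^(wζ)`.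
  rw [← integral_comp_exp, ← integral_exp_mul_div_one_add_exp_horizontal h0 h1
    (φ := -ζ.im) (by simpa using hζ), ← integral_const_mul,
    ← integral_add_right_eq_self _ ζ.re]
  congr 1 with v
  rw [ofReal_exp_cpow, Complex.real_smul, Complex.ofReal_exp]
  have e1 : ((v + ζ.re : ℝ) : ℂ) = ζ + (v + (-ζ.im : ℝ) * Complex.I) := by
    have := Complex.re_add_im ζ
    push_cast
    linear_combination this
  rw [e1]
  set y : ℂ := v + (-ζ.im : ℝ) * Complex.I
  have e2 : Complex.exp ζ / (Complex.exp ζ + Complex.exp (ζ + y)) = 1 / (1 + Complex.exp y) := by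
    rw [Complex.exp_add]
    have := Complex.exp_ne_zero ζ
    rw [← mul_one_add, ← div_div, div_self this]
  rw [e2, mul_div_assoc', mul_div_assoc', mul_div_assoc']
  congr 1
  rw [mul_one, ← Complex.exp_add, ← Complex.exp_add]
  ring_nf

theorem integrableOn_rpow_mul_exp_div_exp_add {σ : ℝ} (h0 : 0 < σ) (h1 : σ < 1) (y : ℝ) :
    IntegrableOn (fun x : ℝ => x ^ (σ - 1) * (Real.exp y / (Real.exp y + x))) (Ioi 0) := by
  rw [← integrable_comp_exp]
  have := ((integrable_exp_mul_div_one_add_exp (w := σ) (by simpa) (by simpa)).norm.comp_sub_right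
    y).const_mul (Real.exp (σ * y))
  refine this.congr (ae_of_all _ fun v => ?_)
  have e1 : ‖1 + Complex.exp ((v - y : ℝ) : ℂ)‖ = 1 + Real.exp (v - y) := by
    rw [← Complex.ofReal_exp, ← Complex.ofReal_one, ← Complex.ofReal_add, Complex.norm_real,
      Real.norm_of_nonneg (by positivity)]
  have hy := Real.exp_pos y
  have hv := Real.exp_pos v
  beta_reduce
  rw [norm_div, Complex.norm_exp, e1, ← Complex.ofReal_mul, Complex.ofReal_re, smul_eq_mul,
    ← Real.exp_mul, Real.exp_sub, ← mul_assoc, ← Real.exp_add, mul_div_assoc', ← Real.exp_add,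
    show σ * y + σ * (v - y) = v + v * (σ - 1) by ring]
  field_simp

theorem integral_rpow_mul_exp_div_exp_add {σ : ℝ} (h0 : 0 < σ) (h1 : σ < 1) (y : ℝ) :
    ∫ x in Ioi (0 : ℝ), x ^ (σ - 1) * (Real.exp y / (Real.exp y + x)) =
      Real.exp (σ * y) * (Real.pi / Real.sin (Real.pi * σ)) := by
  have := integral_cpow_mul_cexp_div_cexp_add (w := σ) (ζ := y) (by simpa) (by simpa)
    (by simpa using Real.pi_pos)
  rw [← Complex.ofReal_inj, ← integral_complex_ofReal]
  push_cast
  rw [← this]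
  refine setIntegral_congr_fun measurableSet_Ioi fun x hx => ?_
  simp [Complex.ofReal_cpow (le_of_lt hx)]

/-! ### Hankel contours and the reciprocal Gamma function. -/

/-- The integral of `f` over the Hankel contour, in logarithmic coordinates: along the lower
horizontal ray `Im w = -θ`, `Re w > L` towards `L - θ i`, up to `L + θ i`, and back to infinity
along the upper ray. -/
noncomputable def hankelIntegral (θ L : ℝ) (f : ℂ → ℂ) : ℂ :=
  (∫ u in Ioi L, f (u + θ * Complex.I)) - (∫ u in Ioi L, f (u + (-θ : ℝ) * Complex.I))
    + Complex.I * ∫ v in (-θ)..θ, f (L + v * Complex.I)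

/-- The arc can be pushed to `Re w = -∞`, that is, shrunk to the origin: by Cauchy's theorem the
difference is a vertical integral that vanishes like `e^(κu)`. -/
theorem hankelIntegral_eq_of_halfStrip {f : ℂ → ℂ} {C κ L θ : ℝ} (hθ : 0 ≤ θ) (hκ : 0 < κ)
    (H : DifferentiableOn ℂ f {w | w.re ≤ L ∧ w.im ∈ Icc (-θ) θ})
    (hb : ∀ u ≤ L, ∀ v ∈ Icc (-θ) θ, ‖f (u + v * Complex.I)‖ ≤ C * Real.exp (κ * u))
    (h1 : IntegrableOn (fun u : ℝ => f (u + θ * Complex.I)) (Ioi L))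
    (h2 : IntegrableOn (fun u : ℝ => f (u + (-θ : ℝ) * Complex.I)) (Ioi L)) :
    hankelIntegral θ L f =
      (∫ u : ℝ, f (u + θ * Complex.I)) - ∫ u : ℝ, f (u + (-θ : ℝ) * Complex.I) := by
  obtain ⟨hi, he⟩ := integral_halfStrip_eq hκ (by linarith) H hb
  rw [← intervalIntegral.integral_Iic_add_Ioi (hi θ ⟨by linarith, le_rfl⟩) h1,
    ← intervalIntegral.integral_Iic_add_Ioi (hi (-θ) ⟨le_rfl, by linarith⟩) h2, hankelIntegral,
    ← he]
  ring

theorem hankelIntegral_deriv_eq_zero {F F' : ℂ → ℂ} {θ L : ℝ}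
    (hd : ∀ w, HasDerivAt F (F' w) w) (hc : Continuous F')
    (hi : ∀ v : ℝ, |v| = θ → IntegrableOn (fun u : ℝ => F' (u + v * Complex.I)) (Ioi L))
    (ht : ∀ v : ℝ, |v| = θ → Tendsto (fun u : ℝ => F (u + v * Complex.I)) atTop (𝓝 0))
    (hθ : 0 ≤ θ) : hankelIntegral θ L F' = 0 := by
  have hray : ∀ v : ℝ, |v| = θ →
      ∫ u in Ioi L, F' (u + v * Complex.I) = -F (L + v * Complex.I) := by
    intro v hv
    have := integral_Ioi_of_hasDerivAt_of_tendsto' (a := L) (m := 0)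
      (f := fun u : ℝ => F (u + v * Complex.I)) (f' := fun u : ℝ => F' (u + v * Complex.I))
      (fun u _ => ?_) (hi v hv) (ht v hv)
    · rw [this, zero_sub]
    · have h := (hd (u + v * Complex.I)).comp (u : ℂ) ((hasDerivAt_id (u : ℂ)).add_const _)
      simpa using h.comp_ofReal
  have harc : ∫ v in (-θ)..θ, Complex.I * F' (L + v * Complex.I) =
      F (L + θ * Complex.I) - F (L + (-θ : ℝ) * Complex.I) := by
    refine intervalIntegral.integral_eq_sub_of_hasDerivAt
      (f := fun v : ℝ => F (L + v * Complex.I)) (fun v _ => ?_)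
      (Continuous.intervalIntegrable (by fun_prop) _ _)
    have h := (hd (L + v * Complex.I)).comp (v : ℂ)
      (((hasDerivAt_id (v : ℂ)).mul_const Complex.I).const_add (L : ℂ))
    simpa [mul_comm] using h.comp_ofReal
  rw [hankelIntegral, hray θ (abs_of_nonneg hθ), hray (-θ) (by rw [abs_neg, abs_of_nonneg hθ]),
    ← intervalIntegral.integral_const_mul, harc]
  ring

theorem norm_cexp_cexp_ray {u v θ : ℝ} (hv : |v| = θ) :
    ‖Complex.exp (Complex.exp (u + v * Complex.I))‖ = Real.exp (Real.cos θ * Real.exp u) := by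
  rw [Complex.norm_exp, Complex.exp_re, ← hv, Real.cos_abs]
  simp [mul_comm]

theorem norm_cexp_ofReal_mul (b u v : ℝ) :
    ‖Complex.exp (b * (u + v * Complex.I))‖ = Real.exp (b * u) := by
  rw [Complex.norm_exp]
  simp

theorem neg_cos_pos {θ : ℝ} (h1 : Real.pi / 2 < θ) (h2 : θ < Real.pi) : 0 < -Real.cos θ :=
  neg_pos.2 (Real.cos_neg_of_pi_div_two_lt_of_lt h1 (by linarith))

theorem integrableOn_Ioi_exp_neg_mul_exp_mul {c : ℝ} (hc : 0 < c) (κ L : ℝ) :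
    IntegrableOn (fun u : ℝ => Real.exp (-c * Real.exp u) * Real.exp (κ * u)) (Ioi L) := by
  -- Integrability on the whole line needs a positive exponent. On `u > L`, raising `κ` to `|κ| + 1`
  -- costs only the constant factor.
  have h := ((integrable_exp_neg_mul_exp_mul hc (κ := |κ| + 1) (by positivity)).const_mul
    (Real.exp ((κ - |κ| - 1) * L))).integrableOn (s := Ioi L)
  refine h.mono' (by fun_prop) ((ae_restrict_mem measurableSet_Ioi).mono fun u hu => ?_)
  rw [Real.norm_of_nonneg (by positivity), mul_left_comm,
    ← Real.exp_add ((κ - |κ| - 1) * L)]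
  have h1 : κ ≤ |κ| := le_abs_self κ
  have h2 : L < u := hu
  refine mul_le_mul_of_nonneg_left (Real.exp_le_exp.2 ?_) (Real.exp_pos _).le
  nlinarith

theorem integrableOn_ray {v θ : ℝ} (h1 : Real.pi / 2 < θ) (h2 : θ < Real.pi) (hv : |v| = θ)
    (b L : ℝ) : IntegrableOn (fun u : ℝ => Complex.exp (Complex.exp (u + v * Complex.I))
      * Complex.exp (b * (u + v * Complex.I))) (Ioi L) := by
  refine (integrableOn_Ioi_exp_neg_mul_exp_mul (neg_cos_pos h1 h2) b L).mono'
    (by fun_prop) (ae_of_all _ fun u => ?_)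
  rw [norm_mul, norm_cexp_cexp_ray hv, norm_cexp_ofReal_mul, neg_neg]

/-- Shifting by `πi` turns `e^(e^w)` into `e^(-e^w)` and the angle `θ` into `θ - π`, which lies in
the sector where the Gamma integral may be rotated. The factor `e^(πib)` comes from `e^(bw)`. -/
theorem integral_ray_upper {b : ℂ} (hb : 0 < b.re) {θ : ℝ} (h1 : Real.pi / 2 < θ)
    (h2 : θ < Real.pi) : ∫ u : ℝ, Complex.exp (Complex.exp (u + θ * Complex.I))
      * Complex.exp (b * (u + θ * Complex.I)) =
        Complex.exp (Real.pi * b * Complex.I) * Complex.Gamma b := by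
  rw [← integral_cexp_neg_cexp hb (ψ := θ - Real.pi) (by rw [abs_lt]; constructor <;> linarith),
    ← integral_const_mul]
  congr 1 with u
  have e1 : (u + θ * Complex.I : ℂ) = (u + (θ - Real.pi : ℝ) * Complex.I) + Real.pi * Complex.I := by
    push_cast; ring
  rw [e1, Complex.exp_add_pi_mul_I, mul_add b, Complex.exp_add (b * _)]
  ring_nf

theorem integral_ray_lower {b : ℂ} (hb : 0 < b.re) {θ : ℝ} (h1 : Real.pi / 2 < θ)
    (h2 : θ < Real.pi) : ∫ u : ℝ, Complex.exp (Complex.exp (u + (-θ : ℝ) * Complex.I))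
      * Complex.exp (b * (u + (-θ : ℝ) * Complex.I)) =
        Complex.exp (-Real.pi * b * Complex.I) * Complex.Gamma b := by
  rw [← integral_cexp_neg_cexp hb (ψ := Real.pi - θ) (by rw [abs_lt]; constructor <;> linarith),
    ← integral_const_mul]
  congr 1 with u
  have e1 : (u + (-θ : ℝ) * Complex.I : ℂ) =
      (u + (Real.pi - θ : ℝ) * Complex.I) - Real.pi * Complex.I := by
    push_cast; ring
  rw [e1, Complex.exp_sub_pi_mul_I, mul_sub b, Complex.exp_sub (b * _), div_eq_mul_inv, ← Complex.exp_neg]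
  ring_nf

theorem sin_pi_mul_Gamma {b : ℂ} (hb : 0 < b.re) :
    Complex.sin (Real.pi * b) * Complex.Gamma b = Real.pi / Complex.Gamma (1 - b) := by
  have h := Complex.Gamma_mul_Gamma_one_sub b
  have hG := Complex.Gamma_ne_zero_of_re_pos hb
  by_cases hs : Complex.sin (Real.pi * b) = 0
  -- Here `Γ(1-b)` is at a pole, where its default value `0` makes both sides vanish.
  · rw [hs, div_zero] at h
    rw [hs, (mul_eq_zero.1 h).resolve_left hG]
    simp
  · have hpi : (Real.pi : ℂ) ≠ 0 := by exact_mod_cast Real.pi_ne_zero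
    have h1 : Complex.Gamma (1 - b) ≠ 0 := by
      intro h0
      rw [h0, mul_zero] at h
      exact div_ne_zero hpi hs h.symm
    rw [eq_div_iff hs] at h
    rw [eq_div_iff h1]
    linear_combination h

theorem exp_sub_exp_mul_Gamma {b : ℂ} (hb : 0 < b.re) :
    Complex.exp (Real.pi * b * Complex.I) * Complex.Gamma b
      - Complex.exp (-Real.pi * b * Complex.I) * Complex.Gamma b =
      2 * Real.pi * Complex.I / Complex.Gamma (1 - b) := by
  have h := sin_pi_mul_Gamma hb
  rw [Complex.sin] at h
  rw [show 2 * Real.pi * Complex.I / Complex.Gamma (1 - b) =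
    2 * Complex.I * (Real.pi / Complex.Gamma (1 - b)) by ring, ← h]
  ring_nf
  simp only [Complex.I_sq]
  ring

theorem hankelIntegral_exp_of_pos {b θ : ℝ} (hb : 0 < b) (h1 : Real.pi / 2 < θ) (h2 : θ < Real.pi)
    (L : ℝ) :
    hankelIntegral θ L (fun w => Complex.exp (Complex.exp w) * Complex.exp (b * w)) =
      2 * Real.pi * Complex.I / Complex.Gamma (1 - b) := by
  have hθ : 0 ≤ θ := by linarith [Real.pi_pos]
  have hb' : 0 < (b : ℂ).re := by simpa
  rw [← exp_sub_exp_mul_Gamma hb', ← integral_ray_upper hb' h1 h2, ← integral_ray_lower hb' h1 h2]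
  refine hankelIntegral_eq_of_halfStrip (C := Real.exp (Real.exp L)) (κ := b) hθ hb
    (Differentiable.differentiableOn (by fun_prop)) (fun u hu v _ => ?_)
    (integrableOn_ray h1 h2 (abs_of_nonneg hθ) b L)
    (integrableOn_ray h1 h2 (by rw [abs_neg, abs_of_nonneg hθ]) b L)
  rw [norm_mul, norm_cexp_ofReal_mul]
  gcongr
  refine (Complex.norm_exp_le_exp_norm _).trans (Real.exp_le_exp.2 ?_)
  rw [Complex.norm_exp]
  simpa using hu

theorem continuousAt_integral_cexp_mul {μ : Measure ℝ} {γ : ℝ → ℂ} (hγ : Continuous γ)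
    (hi : Integrable (fun t => Real.exp |(γ t).re| * ‖Complex.exp (Complex.exp (γ t))‖) μ) :
    ContinuousAt (fun b : ℝ =>
      ∫ t, Complex.exp (Complex.exp (γ t)) * Complex.exp (b * γ t) ∂μ) 0 := by
  refine continuousAt_of_dominated (bound := fun t =>
    Real.exp |(γ t).re| * ‖Complex.exp (Complex.exp (γ t))‖)
    (Eventually.of_forall fun b => by fun_prop) ?_ hi
    (ae_of_all _ fun t => by fun_prop)
  have : ∀ᶠ b : ℝ in 𝓝 0, |b| ≤ 1 := by
    filter_upwards [Metric.ball_mem_nhds (0 : ℝ) one_pos] with b hb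
    simpa using (mem_ball_zero_iff.1 hb).le
  filter_upwards [this] with b hb
  refine ae_of_all _ fun t => ?_
  rw [norm_mul, mul_comm, Complex.norm_exp (b * γ t), Complex.re_ofReal_mul]
  gcongr
  calc b * (γ t).re ≤ |b * (γ t).re| := le_abs_self _
    _ = |b| * |(γ t).re| := abs_mul _ _
    _ ≤ 1 * |(γ t).re| := by gcongr
    _ = _ := one_mul _

theorem continuousAt_hankelIntegral_exp {θ : ℝ} (h1 : Real.pi / 2 < θ) (h2 : θ < Real.pi)
    (L : ℝ) :
    ContinuousAt (fun b : ℝ => hankelIntegral θ L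
      (fun w => Complex.exp (Complex.exp w) * Complex.exp (b * w))) 0 := by
  have hθ : 0 ≤ θ := by linarith [Real.pi_pos]
  have hray : ∀ v : ℝ, |v| = θ → ContinuousAt (fun b : ℝ =>
      ∫ u in Ioi L, Complex.exp (Complex.exp (u + v * Complex.I))
        * Complex.exp (b * (u + v * Complex.I))) 0 := by
    intro v hv
    refine continuousAt_integral_cexp_mul (γ := fun u : ℝ => u + v * Complex.I) (by fun_prop) ?_
    -- The constant comes from `|u| ≤ u + 2|L|` for `u > L`.
    refine ((integrableOn_Ioi_exp_neg_mul_exp_mul (neg_cos_pos h1 h2) 1 L).const_mul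
      (Real.exp (2 * |L|))).mono' (by fun_prop)
      ((ae_restrict_mem measurableSet_Ioi).mono fun u hu => ?_)
    rw [norm_cexp_cexp_ray hv, Real.norm_of_nonneg (by positivity), neg_neg, mul_left_comm,
      mul_comm, ← Real.exp_add (2 * |L|)]
    refine mul_le_mul_of_nonneg_left (Real.exp_le_exp.2 ?_) (Real.exp_pos _).le
    have h3 : L < u := hu
    have h4 := neg_abs_le L
    simp only [Complex.add_re, Complex.ofReal_re, Complex.re_ofReal_mul, Complex.I_re, mul_zero,
      add_zero, one_mul]
    exact abs_le.2 ⟨by linarith [abs_nonneg L], by linarith [abs_nonneg L]⟩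
  have harc : ContinuousAt (fun b : ℝ =>
      ∫ v in (-θ)..θ, Complex.exp (Complex.exp (L + v * Complex.I))
        * Complex.exp (b * (L + v * Complex.I))) 0 := by
    simp_rw [intervalIntegral.integral_of_le (neg_le_self hθ)]
    refine continuousAt_integral_cexp_mul (γ := fun v : ℝ => L + v * Complex.I) (by fun_prop) ?_
    exact (Continuous.integrableOn_Icc (by fun_prop)).mono_set Ioc_subset_Icc_self
  exact ((hray θ (abs_of_nonneg hθ)).sub (hray (-θ) (by rw [abs_neg, abs_of_nonneg hθ]))).add
    (harc.const_mul Complex.I)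

/-- Integration by parts: `e^(e^w) (e^((b+1)w) + b e^(bw))` is the derivative of `e^(e^w) e^(bw)`,
which vanishes at both ends of the contour. This is the functional equation of `1/Γ`. -/
theorem hankelIntegral_exp_add_one {θ : ℝ} (h1 : Real.pi / 2 < θ) (h2 : θ < Real.pi) (b L : ℝ) :
    hankelIntegral θ L (fun w => Complex.exp (Complex.exp w) * Complex.exp ((b + 1 : ℝ) * w)) =
      -b * hankelIntegral θ L (fun w => Complex.exp (Complex.exp w) * Complex.exp (b * w)) := by
  have hθ : 0 ≤ θ := by linarith [Real.pi_pos]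
  have hθ' : |(-θ)| = θ := by rw [abs_neg, abs_of_nonneg hθ]
  set F : ℝ → ℂ → ℂ := fun b w => Complex.exp (Complex.exp w) * Complex.exp (b * w) with hF
  have hz : hankelIntegral θ L (fun w => F (b + 1) w + b * F b w) = 0 := by
    refine hankelIntegral_deriv_eq_zero (F := F b) (fun w => ?_) (by fun_prop) (fun v hv => ?_)
      (fun v hv => ?_) hθ
    · have e1 := (Complex.hasDerivAt_exp w).cexp
      have e2 := ((hasDerivAt_id w).const_mul (b : ℂ)).cexp
      refine (e1.mul e2).congr_deriv ?_
      simp only [hF, id]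
      push_cast
      rw [add_one_mul, Complex.exp_add]
      ring
    · exact (integrableOn_ray h1 h2 hv (b + 1) L).add
        ((integrableOn_ray h1 h2 hv b L).const_mul (b : ℂ))
    · rw [tendsto_zero_iff_norm_tendsto_zero]
      refine (tendsto_exp_neg_mul_exp_mul_atTop b (neg_cos_pos h1 h2)).congr fun u => ?_
      rw [norm_mul, norm_cexp_cexp_ray hv, norm_cexp_ofReal_mul, neg_neg]
  have hc : ∀ c, Continuous (F c) := fun c => by fun_prop
  have hiv : ∀ c, IntervalIntegrable (fun v : ℝ => F c (L + v * Complex.I)) volume (-θ) θ :=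
    fun c => Continuous.intervalIntegrable (by fun_prop) _ _
  have hr : ∀ (v : ℝ), |v| = θ → ∀ c, IntegrableOn (fun u : ℝ => F c (u + v * Complex.I)) (Ioi L) :=
    fun v hv c => integrableOn_ray h1 h2 hv c L
  rw [hankelIntegral, integral_add (hr θ (abs_of_nonneg hθ) _) ((hr θ (abs_of_nonneg hθ) _).const_mul _),
    integral_add (hr _ hθ' _) ((hr _ hθ' _).const_mul _),
    intervalIntegral.integral_add (hiv _) ((hiv _).const_mul _),
    integral_const_mul, integral_const_mul, intervalIntegral.integral_const_mul] at hz
  rw [hankelIntegral, hankelIntegral]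
  linear_combination hz

/-- **Hankel's formula** for the reciprocal of the Gamma function. -/
theorem hankelIntegral_exp_one_sub {θ : ℝ} (h1 : Real.pi / 2 < θ) (h2 : θ < Real.pi) (L : ℝ)
    {a : ℝ} (ha : 0 < a) :
    hankelIntegral θ L (fun w => Complex.exp (Complex.exp w) * Complex.exp ((1 - a : ℝ) * w)) =
      2 * Real.pi * Complex.I / Complex.Gamma a := by
  -- The induction lowers `a` by one until `a ≤ 1`. For `a < 1` the arc collapses, as the exponent
  -- `1 - a` is positive; `a = 1` is the limit of that case as the exponent tends to `0` from above.
  obtain ⟨n, hn⟩ := exists_nat_ge (a - 1)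
  induction n generalizing a with
  | zero =>
    have hle : a ≤ 1 := by simpa using hn
    rcases hle.lt_or_eq with h | rfl
    · have := hankelIntegral_exp_of_pos (sub_pos.2 h) h1 h2 L
      rw [this]
      push_cast
      rw [sub_sub_cancel]
    · have e1 := (continuousAt_hankelIntegral_exp h1 h2 L).tendsto.mono_left
        (nhdsWithin_le_nhds (s := Ioi 0))
      have e2 : Tendsto (fun b : ℝ => 2 * Real.pi * Complex.I * (Complex.Gamma (1 - b))⁻¹)
          (𝓝[>] 0) (𝓝 (2 * Real.pi * Complex.I * (Complex.Gamma (1 - (0 : ℝ)))⁻¹)) := by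
        refine Tendsto.mono_left (Continuous.tendsto ?_ 0) nhdsWithin_le_nhds
        exact (Complex.differentiable_one_div_Gamma.continuous.comp
          (continuous_const.sub Complex.continuous_ofReal)).const_mul _
      have e3 := tendsto_nhds_unique e1 (e2.congr' ?_)
      · simpa [div_eq_mul_inv] using e3
      · filter_upwards [self_mem_nhdsWithin] with b hb
        rw [hankelIntegral_exp_of_pos hb h1 h2, div_eq_mul_inv]
  | succ n ih =>
    rcases le_or_gt a 1 with h | h
    · exact ih ha (by linarith [(Nat.cast_nonneg n : (0 : ℝ) ≤ n)])
    · have e1 := ih (a := a - 1) (by linarith) (by push_cast at hn; linarith)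
      have e2 := hankelIntegral_exp_add_one h1 h2 (1 - a) L
      rw [show 1 - a + 1 = 1 - (a - 1) by ring, e1] at e2
      have e3 : ((a - 1 : ℝ) : ℂ) ≠ 0 := by exact_mod_cast (sub_pos.2 h).ne'
      have e4 := Complex.Gamma_add_one _ e3
      have e5 : Complex.Gamma (a - 1 : ℝ) ≠ 0 :=
        Complex.Gamma_ne_zero_of_re_pos (by simpa using h)
      rw [show ((a - 1 : ℝ) : ℂ) + 1 = a by push_cast; ring] at e4
      rw [e4]
      rw [div_eq_iff e5] at e2
      rw [eq_div_iff (mul_ne_zero e3 e5), e2]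
      push_cast
      ring

/-! ### The Hankel representation of the Mittag-Leffler function. -/

/-- The integrand of the Hankel representation of `E_lam(-x)` in logarithmic coordinates. -/
noncomputable def mittagLefflerKernel (lam x : ℝ) (w : ℂ) : ℂ :=
  Complex.exp (Complex.exp w) * (Complex.exp (lam * w) / (Complex.exp (lam * w) + x))

/-- The condition `λ < 2` says exactly that `π/2 < π/λ`. An angle above `π/2` gives decay of
`e^(e^w)`, and one below `π/λ` keeps `e^(λw) + x` away from zero. -/
theorem exists_hankel_angle {lam : ℝ} (h0 : 0 < lam) (h2 : lam < 2) :
    ∃ θ, Real.pi / 2 < θ ∧ θ < Real.pi ∧ lam * θ < Real.pi := by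
  have hpi := Real.pi_pos
  obtain ⟨θ, ha, hb⟩ := exists_between (show Real.pi / 2 < min Real.pi (Real.pi / lam) from
    lt_min (by linarith) (div_lt_div_of_pos_left hpi h0 h2))
  refine ⟨θ, ha, hb.trans_le (min_le_left _ _), ?_⟩
  have := hb.trans_le (min_le_right _ _)
  rwa [lt_div_iff₀ h0, mul_comm] at this

theorem cexp_ofReal_mul_add_ne_zero {lam x θ : ℝ} (h0 : 0 < lam) (hx : 0 ≤ x)
    (hlθ : lam * θ < Real.pi) {w : ℂ} (hw : |w.im| ≤ θ) : Complex.exp (lam * w) + x ≠ 0 := by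
  have := cexp_add_ofReal_ne_zero (u := lam * w.re) (v := lam * w.im) hx (by
    rw [abs_mul, abs_of_pos h0]
    exact (mul_le_mul_of_nonneg_left hw h0.le).trans_lt hlθ)
  convert this using 3
  conv_lhs => rw [← Complex.re_add_im w]
  push_cast
  ring

theorem norm_exp_div_exp_add_le {lam x u v θ : ℝ} (h0 : 0 < lam) (hx : 0 ≤ x)
    (hlθ : lam * θ < Real.pi) (hv : |v| ≤ θ) :
    ‖Complex.exp (lam * (u + v * Complex.I)) /
      (Complex.exp (lam * (u + v * Complex.I)) + x)‖ ≤
      (Real.cos (lam * θ / 2))⁻¹ * (Real.exp (lam * u) / (Real.exp (lam * u) + x)) := by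
  have hθ : 0 ≤ θ := (abs_nonneg v).trans hv
  have hc := cos_half_pos (mul_nonneg h0.le hθ) hlθ
  have h := cos_half_mul_le_norm_cexp_add (u := lam * u) (v := lam * v) (φ := lam * θ) hx hlθ.le (by
    rw [abs_mul, abs_of_pos h0]
    exact mul_le_mul_of_nonneg_left hv h0.le)
  have e : (lam * (u + v * Complex.I) : ℂ) = (lam * u : ℝ) + (lam * v : ℝ) * Complex.I := by
    push_cast; ring
  rw [norm_div, norm_cexp_ofReal_mul, e]
  calc _ ≤ Real.exp (lam * u) / (Real.cos (lam * θ / 2) * (Real.exp (lam * u) + x)) :=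
        div_le_div_of_nonneg_left (Real.exp_pos _).le (by positivity) h
    _ = _ := by field_simp

theorem differentiableOn_mittagLefflerKernel {lam x θ : ℝ} (h0 : 0 < lam) (hx : 0 ≤ x)
    (hlθ : lam * θ < Real.pi) :
    DifferentiableOn ℂ (mittagLefflerKernel lam x) {w | |w.im| ≤ θ} := by
  intro w hw
  have := cexp_ofReal_mul_add_ne_zero h0 hx hlθ hw
  unfold mittagLefflerKernel
  exact DifferentiableAt.differentiableWithinAt (by fun_prop (disch := assumption))

theorem norm_mittagLefflerKernel_le {lam x u v θ : ℝ} (h0 : 0 < lam) (hx : 0 ≤ x)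
    (hlθ : lam * θ < Real.pi) (hv : |v| = θ) :
    ‖mittagLefflerKernel lam x (u + v * Complex.I)‖ ≤
      Real.exp (Real.cos θ * Real.exp u) *
        ((Real.cos (lam * θ / 2))⁻¹ * (Real.exp (lam * u) / (Real.exp (lam * u) + x))) := by
  rw [mittagLefflerKernel, norm_mul, norm_cexp_cexp_ray hv]
  exact mul_le_mul_of_nonneg_left (norm_exp_div_exp_add_le h0 hx hlθ hv.le) (Real.exp_pos _).le

theorem continuous_mittagLefflerKernel_horizontal {lam x v θ : ℝ} (h0 : 0 < lam) (hx : 0 ≤ x)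
    (hlθ : lam * θ < Real.pi) (hv : |v| = θ) :
    Continuous fun u : ℝ => mittagLefflerKernel lam x (u + v * Complex.I) :=
  (differentiableOn_mittagLefflerKernel h0 hx hlθ).continuousOn.comp_continuous (by fun_prop)
    fun u => by simpa using hv.le

theorem integrableOn_mittagLefflerKernel_Ioi {lam x v θ : ℝ} (h0 : 0 < lam) (hx : 0 ≤ x)
    (h1 : Real.pi / 2 < θ) (h2 : θ < Real.pi) (hlθ : lam * θ < Real.pi) (hv : |v| = θ) (L : ℝ) :
    IntegrableOn (fun u : ℝ => mittagLefflerKernel lam x (u + v * Complex.I)) (Ioi L) := by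
  have hc := cos_half_pos (mul_nonneg h0.le (hv ▸ abs_nonneg v)) hlθ
  refine ((integrableOn_Ioi_exp_neg_mul_exp_mul (neg_cos_pos h1 h2) 0 L).mul_const
    (Real.cos (lam * θ / 2))⁻¹).mono'
    (continuous_mittagLefflerKernel_horizontal h0 hx hlθ hv).aestronglyMeasurable
    (ae_of_all _ fun u => (norm_mittagLefflerKernel_le h0 hx hlθ hv).trans ?_)
  rw [neg_neg, zero_mul, Real.exp_zero, mul_one]
  refine mul_le_mul_of_nonneg_left (mul_le_of_le_one_right (by positivity) ?_) (Real.exp_pos _).le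
  exact div_le_one_of_le₀ (by linarith) (by positivity)

/-- Where `|x e^(-λw)| ≤ q < 1`, the kernel is `e^(e^w)` times a geometric series in `-x e^(-λw)`.
The exponent `-λn` is written as `1 - (λn+1)` to match Hankel's formula at `a = λn + 1`. -/
theorem hasSum_integral_mittagLefflerKernel {lam x q : ℝ} {μ : Measure ℝ} {γ : ℝ → ℂ}
    (hγ : Continuous γ) (hi : Integrable (fun t => Complex.exp (Complex.exp (γ t))) μ)
    (hq : q < 1) (hq0 : 0 ≤ q) (hle : ∀ᵐ t ∂μ, ‖-(x : ℂ) * Complex.exp (-lam * γ t)‖ ≤ q) :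
    HasSum (fun n : ℕ => (∫ t, Complex.exp (Complex.exp (γ t)) *
        Complex.exp ((1 - (lam * n + 1) : ℝ) * γ t) ∂μ) * (-(x : ℂ)) ^ n)
      (∫ t, mittagLefflerKernel lam x (γ t) ∂μ) := by
  set F : ℕ → ℝ → ℂ := fun n t => Complex.exp (Complex.exp (γ t)) *
    (-(x : ℂ) * Complex.exp (-lam * γ t)) ^ n with hF
  have hFn : ∀ n : ℕ, (∫ t, Complex.exp (Complex.exp (γ t)) *
      Complex.exp ((1 - (lam * n + 1) : ℝ) * γ t) ∂μ) * (-(x : ℂ)) ^ n = ∫ t, F n t ∂μ := by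
    intro n
    rw [← integral_mul_const]
    congr 1 with t
    rw [hF]
    simp only [mul_pow, ← Complex.exp_nat_mul]
    push_cast
    ring_nf
  have hFle : ∀ n, ∀ᵐ t ∂μ, ‖F n t‖ ≤ q ^ n * ‖Complex.exp (Complex.exp (γ t))‖ := by
    intro n
    filter_upwards [hle] with t ht
    rw [hF]
    simp only [norm_mul _ (_ ^ n), norm_pow]
    rw [mul_comm]
    gcongr
  have hFi : ∀ n, Integrable (F n) μ := fun n =>
    (hi.norm.const_mul (q ^ n)).mono' (by fun_prop) (hFle n)
  have hs : Summable fun n => ∫ t, ‖F n t‖ ∂μ := by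
    refine Summable.of_nonneg_of_le (fun n => integral_nonneg fun t => norm_nonneg _) (fun n => ?_)
      ((summable_geometric_of_lt_one hq0 hq).mul_right (∫ t, ‖Complex.exp (Complex.exp (γ t))‖ ∂μ))
    rw [← integral_const_mul]
    exact integral_mono_ae (hFi n).norm (hi.norm.const_mul _) (hFle n)
  have h := hasSum_integral_of_summable_integral_norm hFi hs
  simp_rw [hFn]
  have he : ∫ t, ∑' n, F n t ∂μ = ∫ t, mittagLefflerKernel lam x (γ t) ∂μ := ?_
  · rwa [he] at h
  refine integral_congr_ae ?_
  filter_upwards [hle] with t ht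
  have hlt := ht.trans_lt hq
  rw [hF]
  simp only
  rw [tsum_mul_left, tsum_geometric_of_norm_lt_one hlt, mittagLefflerKernel]
  have hne := Complex.exp_ne_zero (lam * γ t)
  have h3 : 1 - -(x : ℂ) * Complex.exp (-lam * γ t) =
      (Complex.exp (lam * γ t) + x) / Complex.exp (lam * γ t) := by
    rw [neg_mul (lam : ℂ), Complex.exp_neg]
    field_simp
    ring
  rw [h3, inv_div]

/-- Far enough from the origin the geometric expansion holds on the whole contour, so no relation
between `λ` and `θ` is needed. Convergence of the Mittag-Leffler series comes as a by-product, with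
no growth estimate for `Γ`. -/
theorem hasSum_mittagLeffler_hankel {lam x θ L : ℝ} (h0 : 0 < lam) (hx : 0 ≤ x)
    (h1 : Real.pi / 2 < θ) (h2 : θ < Real.pi) (hL : x * Real.exp (-lam * L) < 1) :
    HasSum (fun n : ℕ => (-(x : ℂ)) ^ n / Complex.Gamma ((lam : ℂ) * n + 1))
      ((2 * Real.pi * Complex.I)⁻¹ * hankelIntegral θ L (mittagLefflerKernel lam x)) := by
  have hθ : 0 ≤ θ := by linarith [Real.pi_pos]
  have hle : ∀ u v : ℝ, L ≤ u →
      ‖-(x : ℂ) * Complex.exp (-lam * (u + v * Complex.I))‖ ≤ x * Real.exp (-lam * L) := by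
    intro u v hu
    have e := norm_cexp_ofReal_mul (-lam) u v
    push_cast at e
    rw [norm_mul, norm_neg, Complex.norm_real, Real.norm_of_nonneg hx, e]
    refine mul_le_mul_of_nonneg_left (Real.exp_le_exp.2 ?_) hx
    nlinarith
  have hq0 : 0 ≤ x * Real.exp (-lam * L) := by positivity
  have hray : ∀ v : ℝ, |v| = θ → HasSum (fun n : ℕ =>
      (∫ u in Ioi L, Complex.exp (Complex.exp (u + v * Complex.I)) *
        Complex.exp ((1 - (lam * n + 1) : ℝ) * (u + v * Complex.I))) * (-(x : ℂ)) ^ n)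
      (∫ u in Ioi L, mittagLefflerKernel lam x (u + v * Complex.I)) := by
    intro v hv
    refine hasSum_integral_mittagLefflerKernel (γ := fun u : ℝ => u + v * Complex.I)
      (by fun_prop) ?_ hL hq0
      ((ae_restrict_mem measurableSet_Ioi).mono fun u hu => hle u v (le_of_lt hu))
    simpa [IntegrableOn] using integrableOn_ray h1 h2 hv 0 L
  have harc : HasSum (fun n : ℕ =>
      (∫ v in (-θ)..θ, Complex.exp (Complex.exp (L + v * Complex.I)) *
        Complex.exp ((1 - (lam * n + 1) : ℝ) * (L + v * Complex.I))) * (-(x : ℂ)) ^ n)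
      (∫ v in (-θ)..θ, mittagLefflerKernel lam x (L + v * Complex.I)) := by
    simp_rw [intervalIntegral.integral_of_le (neg_le_self hθ)]
    refine hasSum_integral_mittagLefflerKernel (γ := fun v : ℝ => L + v * Complex.I)
      (by fun_prop) ?_ hL hq0 (ae_of_all _ fun v => hle L v le_rfl)
    exact (Continuous.integrableOn_Icc (by fun_prop)).mono_set Ioc_subset_Icc_self
  have h := (((hray θ (abs_of_nonneg hθ)).sub (hray (-θ) (by rw [abs_neg, abs_of_nonneg hθ]))).add
    (harc.mul_left Complex.I)).mul_left (2 * Real.pi * Complex.I)⁻¹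
  rw [hankelIntegral]
  refine Eq.mpr (congrArg (fun f : ℕ → ℂ => HasSum f _) (funext fun n => ?_)) h
  have hG := hankelIntegral_exp_one_sub h1 h2 L (a := lam * n + 1) (by positivity)
  rw [hankelIntegral] at hG
  have hpi : (2 * Real.pi * Complex.I : ℂ) ≠ 0 := Complex.two_pi_I_ne_zero
  rw [← mul_assoc Complex.I, ← sub_mul, ← add_mul, hG]
  push_cast
  field_simp

theorem exists_mul_exp_lt_one {lam : ℝ} (h0 : 0 < lam) (x : ℝ) :
    ∃ L, x * Real.exp (-lam * L) < 1 := by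
  have : Tendsto (fun L : ℝ => x * Real.exp (-lam * L)) atTop (𝓝 (x * 0)) :=
    (Real.tendsto_exp_atBot.comp
      (tendsto_id.const_mul_atTop_of_neg (neg_lt_zero.2 h0))).const_mul x
  rw [mul_zero] at this
  exact (this.eventually (gt_mem_nhds one_pos)).exists

theorem hasSum_mittagLeffler {lam x : ℝ} (h0 : 0 < lam) (hx : 0 ≤ x) :
    HasSum (fun n : ℕ => (-(x : ℂ)) ^ n / Complex.Gamma ((lam : ℂ) * n + 1))
      (mittagLeffler lam (-(x : ℂ))) := by
  obtain ⟨θ, h1, h2⟩ := exists_between (show Real.pi / 2 < Real.pi by linarith [Real.pi_pos])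
  obtain ⟨L, hL⟩ := exists_mul_exp_lt_one h0 x
  exact (hasSum_mittagLeffler_hankel h0 hx h1 h2 hL).summable.hasSum

theorem mittagLeffler_neg_eq_integral {lam x θ : ℝ} (h0 : 0 < lam) (hx : 0 < x)
    (h1 : Real.pi / 2 < θ) (h2 : θ < Real.pi) (hlθ : lam * θ < Real.pi) :
    mittagLeffler lam (-(x : ℂ)) = (2 * Real.pi * Complex.I)⁻¹ *
      ((∫ u : ℝ, mittagLefflerKernel lam x (u + θ * Complex.I))
        - ∫ u : ℝ, mittagLefflerKernel lam x (u + (-θ : ℝ) * Complex.I)) := by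
  have hθ : 0 ≤ θ := by linarith [Real.pi_pos]
  obtain ⟨L, hL⟩ := exists_mul_exp_lt_one h0 x
  have hc := cos_half_pos (mul_nonneg h0.le hθ) hlθ
  rw [(hasSum_mittagLeffler h0 hx.le).unique (hasSum_mittagLeffler_hankel h0 hx.le h1 h2 hL)]
  congr 1
  -- For `u → -∞` the denominator stays comparable to `x > 0`, so the kernel is `O(e^(λu)/x)` and
  -- the arc disappears.
  refine hankelIntegral_eq_of_halfStrip (κ := lam)
    (C := Real.exp (Real.exp L) * ((Real.cos (lam * θ / 2))⁻¹ * x⁻¹)) hθ h0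
    ((differentiableOn_mittagLefflerKernel h0 hx.le hlθ).mono fun w hw => abs_le.2 hw.2)
    (fun u hu v hv => ?_)
    (integrableOn_mittagLefflerKernel_Ioi h0 hx.le h1 h2 hlθ (abs_of_nonneg hθ) L)
    (integrableOn_mittagLefflerKernel_Ioi h0 hx.le h1 h2 hlθ
      (by rw [abs_neg, abs_of_nonneg hθ]) L)
  rw [mittagLefflerKernel, norm_mul, mul_assoc]
  refine mul_le_mul ?_ ((norm_exp_div_exp_add_le h0 hx.le hlθ (abs_le.2 hv)).trans ?_)
    (norm_nonneg _) (Real.exp_pos _).le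
  · refine (Complex.norm_exp_le_exp_norm _).trans (Real.exp_le_exp.2 ?_)
    rw [Complex.norm_exp]
    simpa using hu
  · rw [mul_assoc]
    gcongr
    rw [inv_mul_eq_div]
    exact div_le_div_of_nonneg_left (Real.exp_pos _).le hx (by linarith [Real.exp_pos (lam * u)])

/-! ### Measurability and boundedness on the half-line. -/

theorem measurable_mittagLeffler_neg {lam : ℝ} (h0 : 0 < lam) :
    Measurable fun x : Ici (0 : ℝ) => mittagLeffler lam (-((x : ℝ) : ℂ)) := by
  refine measurable_of_tendsto_metrizable (f := fun N : ℕ => fun x : Ici (0 : ℝ) =>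
    ∑ n ∈ Finset.range N, (-((x : ℝ) : ℂ)) ^ n / Complex.Gamma ((lam : ℂ) * n + 1))
    (fun N => by fun_prop) ?_
  rw [tendsto_pi_nhds]
  exact fun x => (hasSum_mittagLeffler h0 x.2).tendsto_sum_nat

/-- For `x ≤ 1` the power series is dominated by its coefficients. For `x ≥ 1` the integrals over
the rays are bounded independently of `x`, because `e^(λu) + x ≥ 1`. -/
theorem exists_norm_mittagLeffler_neg_le {lam : ℝ} (h0 : 0 < lam) (hlam2 : lam < 2) :
    ∃ C, ∀ x : ℝ, 0 ≤ x → ‖mittagLeffler lam (-(x : ℂ))‖ ≤ C := by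
  obtain ⟨θ, h1, h2, hlθ⟩ := exists_hankel_angle h0 hlam2
  have hθ : 0 ≤ θ := by linarith [Real.pi_pos]
  have hc := cos_half_pos (mul_nonneg h0.le hθ) hlθ
  have hs : Summable fun n : ℕ => ‖(Complex.Gamma ((lam : ℂ) * n + 1))⁻¹‖ := by
    refine (hasSum_mittagLeffler h0 zero_le_one).summable.norm.congr fun n => ?_
    simp
  set g : ℝ → ℝ := fun u => Real.exp (Real.cos θ * Real.exp u) *
    ((Real.cos (lam * θ / 2))⁻¹ * Real.exp (lam * u)) with hg
  have hgi : Integrable g := by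
    refine ((integrable_exp_neg_mul_exp_mul (neg_cos_pos h1 h2) h0).const_mul
      (Real.cos (lam * θ / 2))⁻¹).congr (ae_of_all _ fun u => ?_)
    simp only [hg, neg_neg]
    ring
  refine ⟨max (∑' n : ℕ, ‖(Complex.Gamma ((lam : ℂ) * n + 1))⁻¹‖)
    (‖(2 * Real.pi * Complex.I : ℂ)⁻¹‖ * ((∫ u, g u) + ∫ u, g u)), fun x hx => ?_⟩
  rcases le_total x 1 with hx1 | hx1
  · refine le_max_of_le_left ?_
    refine tsum_of_norm_bounded hs.hasSum fun n => ?_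
    rw [div_eq_mul_inv, norm_mul, norm_pow, norm_neg, Complex.norm_real, Real.norm_of_nonneg hx]
    exact mul_le_of_le_one_left (norm_nonneg _) (pow_le_one₀ hx hx1)
  · refine le_max_of_le_right ?_
    rw [mittagLeffler_neg_eq_integral h0 (by linarith) h1 h2 hlθ, norm_mul]
    have hray : ∀ v : ℝ, |v| = θ →
        ‖∫ u : ℝ, mittagLefflerKernel lam x (u + v * Complex.I)‖ ≤ ∫ u, g u := by
      intro v hv
      refine norm_integral_le_of_norm_le hgi (ae_of_all _ fun u =>
        (norm_mittagLefflerKernel_le h0 hx hlθ hv).trans ?_)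
      simp only [hg]
      gcongr
      exact div_le_self (Real.exp_pos _).le (by linarith [Real.exp_pos (lam * u)])
    gcongr
    exact (norm_sub_le _ _).trans (add_le_add (hray θ (abs_of_nonneg hθ))
      (hray (-θ) (by rw [abs_neg, abs_of_nonneg hθ])))

/-! ### The Mellin transform of the Mittag-Leffler function. -/

/-- The dominating function integrates in `x` to a constant times `e^(λ Re(w) u)` by the real
Stieltjes integral. The factor `e^(cos θ e^u)` then controls `u → ∞`, and `λ Re w > 0` controls `u →
-∞`. -/
theorem integrable_cpow_mul_mittagLefflerKernel {lam v θ : ℝ} {w : ℂ} (h0 : 0 < lam)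
    (h1 : Real.pi / 2 < θ) (h2 : θ < Real.pi) (hlθ : lam * θ < Real.pi) (hv : |v| = θ)
    (hw0 : 0 < w.re) (hw1 : w.re < 1) :
    Integrable (fun p : ℝ × ℝ => (p.1 : ℂ) ^ (w - 1) *
      mittagLefflerKernel lam p.1 (p.2 + v * Complex.I)) ((volume.restrict (Ioi 0)).prod volume) := by
  set M : ℝ × ℝ → ℝ := fun p => (Real.exp (Real.cos θ * Real.exp p.2) *
    (Real.cos (lam * θ / 2))⁻¹) * (p.1 ^ (w.re - 1) *
      (Real.exp (lam * p.2) / (Real.exp (lam * p.2) + p.1))) with hM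
  have hc := cos_half_pos (mul_nonneg h0.le (hv ▸ abs_nonneg v)) hlθ
  have hMpos : ∀ p : ℝ × ℝ, p.1 ∈ Ioi (0 : ℝ) → 0 ≤ M p := fun p hp => by
    have : 0 < p.1 := hp
    simp only [hM]
    positivity
  have hMi : Integrable M ((volume.restrict (Ioi 0)).prod volume) := by
    rw [integrable_prod_iff' (Measurable.aestronglyMeasurable (by fun_prop))]
    refine ⟨ae_of_all _ fun u =>
      (integrableOn_rpow_mul_exp_div_exp_add hw0 hw1 (lam * u)).const_mul
        (Real.exp (Real.cos θ * Real.exp u) * (Real.cos (lam * θ / 2))⁻¹), ?_⟩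
    refine (((integrable_exp_neg_mul_exp_mul (neg_cos_pos h1 h2) (mul_pos hw0 h0)).mul_const
      ((Real.cos (lam * θ / 2))⁻¹ * (Real.pi / Real.sin (Real.pi * w.re))))).congr
      (ae_of_all _ fun u => ?_)
    have : ∫ x in Ioi (0 : ℝ), ‖M (x, u)‖ = ∫ x in Ioi (0 : ℝ), M (x, u) :=
      setIntegral_congr_fun measurableSet_Ioi fun x hx => Real.norm_of_nonneg (hMpos (x, u) hx)
    beta_reduce
    rw [this]
    simp only [hM]
    rw [integral_const_mul, integral_rpow_mul_exp_div_exp_add hw0 hw1, neg_neg]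
    ring_nf
  refine hMi.mono' (Measurable.aestronglyMeasurable ?_) ?_
  · unfold mittagLefflerKernel
    fun_prop
  · have : ∀ᵐ p : ℝ × ℝ ∂((volume.restrict (Ioi 0)).prod volume), p.1 ∈ Ioi (0 : ℝ) :=
      Measure.quasiMeasurePreserving_fst.ae (ae_restrict_mem measurableSet_Ioi)
    filter_upwards [this] with p hp
    rw [norm_mul, Complex.norm_cpow_eq_rpow_re_of_pos hp, Complex.sub_re, Complex.one_re]
    have h3 := norm_mittagLefflerKernel_le (u := p.2) h0 (le_of_lt hp) hlθ hv
    have hp' : 0 < p.1 := hp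
    refine (mul_le_mul_of_nonneg_left h3 (by positivity)).trans_eq ?_
    simp only [hM]
    ring

theorem integral_cpow_mul_mittagLefflerKernel {lam v θ : ℝ} {w : ℂ} (h0 : 0 < lam)
    (h1 : Real.pi / 2 < θ) (h2 : θ < Real.pi) (hlθ : lam * θ < Real.pi) (hv : |v| = θ)
    (hw0 : 0 < w.re) (hw1 : w.re < 1) :
    ∫ x in Ioi (0 : ℝ), (x : ℂ) ^ (w - 1) *
        ∫ u : ℝ, mittagLefflerKernel lam x (u + v * Complex.I) =
      (Real.pi / Complex.sin (Real.pi * w)) *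
        ∫ u : ℝ, Complex.exp (Complex.exp (u + v * Complex.I)) *
          Complex.exp ((w * lam) * (u + v * Complex.I)) := by
  have hi := integrable_cpow_mul_mittagLefflerKernel h0 h1 h2 hlθ hv hw0 hw1
  simp_rw [← integral_const_mul]
  rw [integral_integral_swap hi]
  congr 1 with u
  have him : |((lam : ℂ) * (u + v * Complex.I)).im| < Real.pi := by
    simpa [abs_mul, abs_of_pos h0, hv] using hlθ
  have := integral_cpow_mul_cexp_div_cexp_add hw0 hw1 him
  simp only [mittagLefflerKernel]
  simp_rw [mul_left_comm _ (Complex.exp (Complex.exp _))]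
  rw [integral_const_mul, this]
  ring_nf

/-- The Mellin transform of `x ↦ E_lam(-x)`. -/
theorem hasMellin_mittagLeffler_neg {lam : ℝ} {w : ℂ} (h0 : 0 < lam) (hlam2 : lam < 2)
    (hw0 : 0 < w.re) (hw1 : w.re < 1) :
    HasMellin (fun x : ℝ => mittagLeffler lam (-(x : ℂ))) w
      (Real.pi / (Complex.sin (Real.pi * w) * Complex.Gamma (1 - w * lam))) := by
  obtain ⟨θ, h1, h2, hlθ⟩ := exists_hankel_angle h0 hlam2
  have hθ : 0 ≤ θ := by linarith [Real.pi_pos]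
  have hθ' : |(-θ)| = θ := by rw [abs_neg, abs_of_nonneg hθ]
  have hi : ∀ v : ℝ, |v| = θ → IntegrableOn (fun x : ℝ => (x : ℂ) ^ (w - 1) *
      ∫ u : ℝ, mittagLefflerKernel lam x (u + v * Complex.I)) (Ioi 0) := by
    intro v hv
    have := (integrable_cpow_mul_mittagLefflerKernel h0 h1 h2 hlθ hv hw0 hw1).integral_prod_left
    simpa only [integral_const_mul, IntegrableOn] using this
  have heq : EqOn (fun x : ℝ => (2 * Real.pi * Complex.I)⁻¹ *
      ((x : ℂ) ^ (w - 1) * (∫ u : ℝ, mittagLefflerKernel lam x (u + θ * Complex.I)) -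
      (x : ℂ) ^ (w - 1) * ∫ u : ℝ, mittagLefflerKernel lam x (u + (-θ : ℝ) * Complex.I)))
      (fun x : ℝ => (x : ℂ) ^ (w - 1) • mittagLeffler lam (-(x : ℂ))) (Ioi 0) := by
    intro x hx
    simp only [smul_eq_mul]
    rw [mittagLeffler_neg_eq_integral h0 hx h1 h2 hlθ]
    ring
  have hI := ((hi θ (abs_of_nonneg hθ)).sub (hi (-θ) hθ')).const_mul (2 * Real.pi * Complex.I)⁻¹
  refine ⟨IntegrableOn.congr_fun hI heq measurableSet_Ioi, ?_⟩
  have hwl : 0 < (w * lam).re := by simpa using mul_pos hw0 h0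
  rw [mellin, ← setIntegral_congr_fun measurableSet_Ioi heq, integral_const_mul,
    integral_sub (hi θ (abs_of_nonneg hθ)) (hi (-θ) hθ'),
    integral_cpow_mul_mittagLefflerKernel h0 h1 h2 hlθ (abs_of_nonneg hθ) hw0 hw1,
    integral_cpow_mul_mittagLefflerKernel h0 h1 h2 hlθ hθ' hw0 hw1,
    integral_ray_upper hwl h1 h2, integral_ray_lower hwl h1 h2, ← mul_sub,
    exp_sub_exp_mul_Gamma hwl]
  have hpi : (2 * Real.pi * Complex.I : ℂ) ≠ 0 := Complex.two_pi_I_ne_zero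
  rw [mul_left_comm, mul_div_assoc', inv_mul_cancel₀ hpi, div_mul_div_comm, mul_one]

theorem mittagLeffler_one (x : ℂ) : mittagLeffler 1 x = Complex.exp x := by
  rw [mittagLeffler, Complex.exp_eq_exp_ℂ, NormedSpace.exp_eq_tsum_div]
  congr 1 with n
  rw [Complex.ofReal_one, one_mul, Complex.Gamma_nat_eq_factorial]

/-- Here the transform is `Γ(w)` with no upper bound on `Re w`; the reflection formula puts it in
the common form wherever `sin(πw) ≠ 0`. -/
theorem hasMellin_mittagLeffler_one_neg {w : ℂ} (hw0 : 0 < w.re)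
    (hsin : Complex.sin (Real.pi * w) ≠ 0) :
    HasMellin (fun x : ℝ => mittagLeffler 1 (-(x : ℂ))) w
      (Real.pi / (Complex.sin (Real.pi * w) * Complex.Gamma (1 - w * (1 : ℝ)))) := by
  have heq : EqOn (fun x : ℝ => ((Real.exp (-x) : ℝ) : ℂ) * (x : ℂ) ^ (w - 1))
      (fun x : ℝ => (x : ℂ) ^ (w - 1) • mittagLeffler 1 (-(x : ℂ))) (Ioi 0) := fun x _ => by
    simp only [mittagLeffler_one, smul_eq_mul]
    push_cast
    ring
  refine ⟨IntegrableOn.congr_fun (Complex.GammaIntegral_convergent hw0) heq measurableSet_Ioi, ?_⟩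
  have h := sin_pi_mul_Gamma hw0
  rw [mellin, ← setIntegral_congr_fun measurableSet_Ioi heq, ← Complex.GammaIntegral,
    ← Complex.Gamma_eq_integral hw0, Complex.ofReal_one, mul_one, mul_comm, ← div_div, ← h]
  field_simp

/-! ### The binomial series and Euler's integral. -/

/-- The coefficients `(η)_n zⁿ / n!` of the binomial series of `(1 - z)^(-η)`. -/
noncomputable def binomialCoeff (η z : ℂ) (n : ℕ) : ℂ :=
  (ascPochhammer ℂ n).eval η * (z ^ n / (n.factorial : ℂ))

theorem summable_norm_binomialCoeff (η : ℂ) {z : ℂ} (hz : ‖z‖ < 1) :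
    Summable fun n => ‖binomialCoeff η z n‖ := by
  obtain ⟨ρ, h1, h2⟩ := exists_between hz
  refine summable_of_ratio_norm_eventually_le (r := ρ) h2 ?_
  -- From this index on `‖η‖‖z‖ ≤ n(ρ - ‖z‖)`, hence `(‖η‖ + n)‖z‖ ≤ ρn`, and the ratio of
  -- consecutive terms is at most `ρ`.
  obtain ⟨N, hN⟩ := exists_nat_ge (‖η‖ * ‖z‖ / (ρ - ‖z‖))
  filter_upwards [eventually_ge_atTop N] with n hn
  have hrec : binomialCoeff η z (n + 1) = binomialCoeff η z n * ((η + n) * z / (n + 1)) := by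
    rw [binomialCoeff, binomialCoeff, ascPochhammer_succ_eval, Nat.factorial_succ, pow_succ]
    push_cast
    have : (n : ℂ) + 1 ≠ 0 := by exact_mod_cast n.succ_ne_zero
    field_simp
  have hn1 : ‖(n : ℂ) + 1‖ = n + 1 := by
    exact_mod_cast Complex.norm_natCast (n + 1)
  rw [hrec, norm_norm, norm_norm, norm_mul, mul_comm]
  refine mul_le_mul_of_nonneg_right ?_ (norm_nonneg _)
  rw [norm_div, hn1, div_le_iff₀ (by positivity), norm_mul]
  have h3 : ‖η + n‖ ≤ ‖η‖ + n := (norm_add_le _ _).trans_eq (by rw [Complex.norm_natCast])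
  have h4 : ‖η‖ * ‖z‖ ≤ n * (ρ - ‖z‖) := by
    rw [← div_le_iff₀ (sub_pos.2 h1)]
    exact hN.trans (by exact_mod_cast hn)
  have h5 := mul_le_mul_of_nonneg_right h3 (norm_nonneg z)
  have h6 : 0 ≤ ρ := (norm_nonneg z).trans h1.le
  nlinarith

/-- The binomial series `∑ (η)_n (z t)ⁿ / n!` as a function of `t`. -/
noncomputable def binomialSum (η z : ℂ) (t : ℝ) : ℂ :=
  ∑' n, binomialCoeff η z n * (t : ℂ) ^ n

theorem norm_binomialCoeff_mul_pow_le (η z : ℂ) (n : ℕ) {t : ℝ} (ht : t ∈ Ioo (0 : ℝ) 1) :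
    ‖binomialCoeff η z n * (t : ℂ) ^ n‖ ≤ ‖binomialCoeff η z n‖ := by
  rw [norm_mul, norm_pow, Complex.norm_real, Real.norm_of_nonneg ht.1.le]
  exact mul_le_of_le_one_right (norm_nonneg _) (pow_le_one₀ ht.1.le ht.2.le)

theorem norm_binomialSum_le (η : ℂ) {z : ℂ} (hz : ‖z‖ < 1) {t : ℝ} (ht : t ∈ Ioo (0 : ℝ) 1) :
    ‖binomialSum η z t‖ ≤ ∑' n, ‖binomialCoeff η z n‖ :=
  tsum_of_norm_bounded (summable_norm_binomialCoeff η hz).hasSum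
    fun n => norm_binomialCoeff_mul_pow_le η z n ht

theorem aestronglyMeasurable_binomialSum (η : ℂ) {z : ℂ} (hz : ‖z‖ < 1) :
    AEStronglyMeasurable (binomialSum η z) (volume.restrict (Ioo 0 1)) :=
  (continuousOn_tsum (fun n => by fun_prop) (summable_norm_binomialCoeff η hz)
    fun n _ ht => norm_binomialCoeff_mul_pow_le η z n ht).aestronglyMeasurable measurableSet_Ioo

theorem integrableOn_pow_mul {g : ℝ → ℂ} (hg : IntegrableOn g (Ioo 0 1)) (n : ℕ) :
    IntegrableOn (fun t : ℝ => (t : ℂ) ^ n * g t) (Ioo 0 1) := by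
  refine Integrable.bdd_mul (c := 1) hg (by fun_prop)
    ((ae_restrict_mem measurableSet_Ioo).mono fun t ht => ?_)
  rw [norm_pow, Complex.norm_real, Real.norm_of_nonneg ht.1.le]
  exact pow_le_one₀ ht.1.le ht.2.le

theorem integrableOn_binomialSum_mul (η : ℂ) {z : ℂ} (hz : ‖z‖ < 1) {g : ℝ → ℂ}
    (hg : IntegrableOn g (Ioo 0 1)) :
    IntegrableOn (fun t : ℝ => binomialSum η z t * g t) (Ioo 0 1) :=
  Integrable.bdd_mul hg (aestronglyMeasurable_binomialSum η hz)
    ((ae_restrict_mem measurableSet_Ioo).mono fun _ ht => norm_binomialSum_le η hz ht)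

theorem hasSum_binomialCoeff_mul_integral (η : ℂ) {z : ℂ} (hz : ‖z‖ < 1) {g : ℝ → ℂ}
    (hg : IntegrableOn g (Ioo 0 1)) :
    HasSum (fun n : ℕ => binomialCoeff η z n * ∫ t in Ioo (0 : ℝ) 1, (t : ℂ) ^ n * g t)
      (∫ t in Ioo (0 : ℝ) 1, binomialSum η z t * g t) := by
  have hi : ∀ n, IntegrableOn (fun t : ℝ => binomialCoeff η z n * ((t : ℂ) ^ n * g t)) (Ioo 0 1) :=
    fun n => (integrableOn_pow_mul hg n).const_mul _
  have hs : Summable fun n =>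
      ∫ t in Ioo (0 : ℝ) 1, ‖binomialCoeff η z n * ((t : ℂ) ^ n * g t)‖ := by
    refine Summable.of_nonneg_of_le (fun n => integral_nonneg fun t => norm_nonneg _) (fun n => ?_)
      ((summable_norm_binomialCoeff η hz).mul_right (∫ t in Ioo (0 : ℝ) 1, ‖g t‖))
    rw [← integral_const_mul]
    refine setIntegral_mono_on (hi n).norm (hg.norm.const_mul _) measurableSet_Ioo fun t ht => ?_
    rw [← mul_assoc, norm_mul]
    exact mul_le_mul_of_nonneg_right (norm_binomialCoeff_mul_pow_le η z n ht) (norm_nonneg _)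
  have h := hasSum_integral_of_summable_integral_norm hi hs
  simp_rw [integral_const_mul, ← mul_assoc, tsum_mul_right] at h
  exact h

theorem integrableOn_beta {a b : ℂ} (ha : 0 < a.re) (hb : 0 < b.re) :
    IntegrableOn (fun t : ℝ => (t : ℂ) ^ (a - 1) * (1 - (t : ℂ)) ^ (b - 1)) (Ioo 0 1) := by
  have := Complex.betaIntegral_convergent ha hb
  rw [intervalIntegrable_iff_integrableOn_Ioc_of_le zero_le_one] at this
  exact this.mono_set Ioo_subset_Ioc_self

theorem betaIntegral_eq_setIntegral (a b : ℂ) :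
    Complex.betaIntegral a b =
      ∫ t in Ioo (0 : ℝ) 1, (t : ℂ) ^ (a - 1) * (1 - (t : ℂ)) ^ (b - 1) := by
  rw [Complex.betaIntegral, intervalIntegral.integral_of_le zero_le_one,
    integral_Ioc_eq_integral_Ioo]

theorem ascPochhammer_eval_mul_Gamma {a : ℂ} (ha : 0 < a.re) (n : ℕ) :
    (ascPochhammer ℂ n).eval a * Complex.Gamma a = Complex.Gamma (a + n) := by
  induction n with
  | zero => simp
  | succ n ih =>
    have : a + n ≠ 0 := fun h => by
      have := congrArg Complex.re h
      simp at this
      linarith [(Nat.cast_nonneg n : (0 : ℝ) ≤ n)]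
    rw [ascPochhammer_succ_eval, Nat.cast_succ, ← add_assoc, Complex.Gamma_add_one _ this, ← ih]
    ring

theorem betaIntegral_add_nat {a b : ℂ} (ha : 0 < a.re) (hb : 0 < b.re) (n : ℕ) :
    Complex.betaIntegral (a + n) b = Complex.betaIntegral a b *
      ((ascPochhammer ℂ n).eval a * ((ascPochhammer ℂ n).eval (a + b))⁻¹) := by
  have hab : 0 < (a + b).re := by simpa using add_pos ha hb
  have han : 0 < (a + n).re := by simpa using add_pos_of_pos_of_nonneg ha n.cast_nonneg
  have habn : 0 < (a + b + n).re := by simpa using add_pos_of_pos_of_nonneg hab n.cast_nonneg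
  have h1 := Complex.Gamma_mul_Gamma_eq_betaIntegral ha hb
  have h2 := Complex.Gamma_mul_Gamma_eq_betaIntegral han hb
  rw [add_right_comm, ← ascPochhammer_eval_mul_Gamma ha, ← ascPochhammer_eval_mul_Gamma hab] at h2
  have hG := Complex.Gamma_ne_zero_of_re_pos hab
  have hP : (ascPochhammer ℂ n).eval (a + b) ≠ 0 := fun h => by
    have := ascPochhammer_eval_mul_Gamma hab n
    rw [h, zero_mul] at this
    exact Complex.Gamma_ne_zero_of_re_pos habn this.symm
  rw [← mul_assoc, ← div_eq_mul_inv, eq_div_iff hP]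
  apply mul_right_cancel₀ hG
  linear_combination -h2 + (ascPochhammer ℂ n).eval a * h1

theorem pow_mul_cpow_sub_one {t : ℝ} (ht : 0 < t) (a : ℂ) (n : ℕ) :
    (t : ℂ) ^ (a + n - 1) = (t : ℂ) ^ n * (t : ℂ) ^ (a - 1) := by
  rw [← Complex.cpow_natCast, ← Complex.cpow_add _ _ (by exact_mod_cast ht.ne')]
  ring_nf

/-- Euler's integral, taken termwise: the moment of order `n` is `B(a+n, b) = B(a, b)
(a)_n/(a+b)_n`, which supplies the missing Pochhammer quotient. -/
theorem integral_binomialSum_mul_beta (η : ℂ) {z a b : ℂ} (hz : ‖z‖ < 1) (ha : 0 < a.re)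
    (hb : 0 < b.re) :
    ∫ t in Ioo (0 : ℝ) 1, binomialSum η z t * ((t : ℂ) ^ (a - 1) * (1 - (t : ℂ)) ^ (b - 1)) =
      Complex.betaIntegral a b * ordinaryHypergeometric η a (a + b) z := by
  rw [← (hasSum_binomialCoeff_mul_integral η hz (integrableOn_beta ha hb)).tsum_eq,
    ordinaryHypergeometric, ordinaryHypergeometric_sum_eq, ← tsum_mul_left]
  congr 1 with n
  have h := betaIntegral_add_nat ha hb n
  rw [betaIntegral_eq_setIntegral (a + n)] at h
  have he : ∫ t in Ioo (0 : ℝ) 1, (t : ℂ) ^ n * ((t : ℂ) ^ (a - 1) * (1 - (t : ℂ)) ^ (b - 1)) =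
      ∫ t in Ioo (0 : ℝ) 1, (t : ℂ) ^ (a + n - 1) * (1 - (t : ℂ)) ^ (b - 1) :=
    setIntegral_congr_fun measurableSet_Ioo fun t ht => by
      simp only [pow_mul_cpow_sub_one ht.1, mul_assoc]
  rw [he, h, binomialCoeff, smul_eq_mul]
  ring

/-! ### Dilations and Fubini for a general profile. -/

section Scaling

variable {e : ℝ → ℂ} {r M : ℂ} {d : ℝ}

theorem HasMellin.integrableOn_comp_div (h : HasMellin e r M) (hd : 0 < d) :
    IntegrableOn (fun p : ℝ => (p : ℂ) ^ (r - 1) * e (p / d)) (Ioi 0) := by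
  have := (MellinConvergent.comp_mul_left (inv_pos.2 hd)).2 h.1
  simpa only [MellinConvergent, smul_eq_mul, inv_mul_eq_div] using this

theorem HasMellin.integral_comp_div (h : HasMellin e r M) (hd : 0 < d) :
    ∫ p in Ioi (0 : ℝ), (p : ℂ) ^ (r - 1) * e (p / d) = (d : ℂ) ^ r * M := by
  have := mellin_comp_mul_left e r (inv_pos.2 hd)
  rw [h.2, Complex.ofReal_inv, Complex.inv_cpow _ _ (by
    rw [Complex.arg_ofReal_of_nonneg hd.le]; exact Real.pi_ne_zero.symm), Complex.cpow_neg,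
    inv_inv] at this
  simpa only [mellin, smul_eq_mul, inv_mul_eq_div] using this

theorem integral_norm_cpow_mul_comp_div (hd : 0 < d) :
    ∫ p in Ioi (0 : ℝ), ‖(p : ℂ) ^ (r - 1) * e (p / d)‖ =
      d ^ r.re * ∫ p in Ioi (0 : ℝ), ‖(p : ℂ) ^ (r - 1) * e p‖ := by
  have := integral_comp_mul_left_Ioi (fun x : ℝ => ‖(x : ℂ) ^ (r - 1) * e x‖) 0 (inv_pos.2 hd)
  rw [inv_inv, mul_zero, smul_eq_mul] at this
  have h2 : d ^ r.re = d ^ (r.re - 1) * d := by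
    rw [← Real.rpow_add_one hd.ne', sub_add_cancel]
  rw [h2, mul_assoc, ← this, ← integral_const_mul]
  refine setIntegral_congr_fun measurableSet_Ioi fun p hp => ?_
  have hp' : 0 < p := hp
  have hpd : 0 < d⁻¹ * p := by positivity
  simp only [norm_mul]
  rw [Complex.norm_cpow_eq_rpow_re_of_pos hp', Complex.norm_cpow_eq_rpow_re_of_pos hpd,
    Complex.sub_re, Complex.one_re, ← mul_assoc, ← Real.mul_rpow hd.le hpd.le,
    mul_inv_cancel_left₀ hd.ne', inv_mul_eq_div]

end Scaling

/-- The integrand of the extended beta function for a general profile `e` in place of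
`x ↦ E_lam(-x)`. -/
noncomputable def profileBetaIntegrand (e : ℝ → ℂ) (σ τ : ℝ) (a b : ℂ) (p q t : ℝ) : ℂ :=
  (t : ℂ) ^ (a - 1) * (1 - (t : ℂ)) ^ (b - 1) * e (p / t ^ σ) * e (q / (1 - t) ^ τ)

theorem integrableOn_profileBetaIntegrand {e : ℝ → ℂ} (he : Measurable e) {C : ℝ}
    (hC : ∀ x, ‖e x‖ ≤ C) (σ τ : ℝ) {a b : ℂ} (ha : 0 < a.re) (hb : 0 < b.re) (p q : ℝ) :
    IntegrableOn (profileBetaIntegrand e σ τ a b p q) (Ioo 0 1) := by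
  have h1 := Integrable.bdd_mul (f := fun t : ℝ => e (p / t ^ σ)) (integrableOn_beta ha hb)
    (Measurable.aestronglyMeasurable (by fun_prop)) (ae_of_all _ fun t => hC _)
  have h2 := Integrable.bdd_mul (f := fun t : ℝ => e (q / (1 - t) ^ τ)) h1
    (Measurable.aestronglyMeasurable (by fun_prop)) (ae_of_all _ fun t => hC _)
  refine h2.congr (ae_of_all _ fun t => ?_)
  simp only [profileBetaIntegrand]
  ring

section Fubini

variable {e : ℝ → ℂ} {σ τ : ℝ} {a b r s η z Mr Ms : ℂ}

theorem ofReal_rpow_cpow_mul {t : ℝ} (ht : 0 < t) (σ : ℝ) (a r : ℂ) :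
    (t : ℂ) ^ (a - 1) * ((t ^ σ : ℝ) : ℂ) ^ r = (t : ℂ) ^ (a + σ * r - 1) := by
  rw [← Complex.cpow_mul_ofReal_nonneg ht.le, ← Complex.cpow_add _ _ (by exact_mod_cast ht.ne')]
  ring_nf

theorem binomialSum_mul_profile_eq (p q t : ℝ) :
    (p : ℂ) ^ (r - 1) * (q : ℂ) ^ (s - 1) *
        (binomialSum η z t * profileBetaIntegrand e σ τ a b p q t) =
      (binomialSum η z t * ((t : ℂ) ^ (a - 1) * (1 - (t : ℂ)) ^ (b - 1))) *
        (((p : ℂ) ^ (r - 1) * e (p / t ^ σ)) * ((q : ℂ) ^ (s - 1) * e (q / (1 - t) ^ τ))) := by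
  rw [profileBetaIntegrand]
  ring

/-- For fixed `t` the integrand is a product in `p` and `q`. Dilation makes its absolute integral a
constant times `|t^(σr)| |(1-t)^(τs)|`, so the condition in `t` is integrability of the beta
integrand with parameters `a + σr` and `b + τs`, the binomial sum being bounded. -/
theorem integrable_binomialSum_mul_profile (he : Measurable e) (hr : HasMellin e r Mr)
    (hs : HasMellin e s Ms) (hz : ‖z‖ < 1) (ha : 0 < (a + σ * r).re) (hb : 0 < (b + τ * s).re) :
    Integrable (fun x : (ℝ × ℝ) × ℝ => (x.1.1 : ℂ) ^ (r - 1) * (x.1.2 : ℂ) ^ (s - 1) *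
        (binomialSum η z x.2 * profileBetaIntegrand e σ τ a b x.1.1 x.1.2 x.2))
      (((volume.restrict (Ioi 0)).prod (volume.restrict (Ioi 0))).prod
        (volume.restrict (Ioo 0 1))) := by
  have hA : AEStronglyMeasurable (fun x : (ℝ × ℝ) × ℝ => binomialSum η z x.2)
      (((volume.restrict (Ioi 0)).prod (volume.restrict (Ioi 0))).prod
        (volume.restrict (Ioo 0 1))) := (aestronglyMeasurable_binomialSum η hz).comp_snd
  have hm : AEStronglyMeasurable (fun x : (ℝ × ℝ) × ℝ => (x.1.1 : ℂ) ^ (r - 1) *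
      (x.1.2 : ℂ) ^ (s - 1) *
        (binomialSum η z x.2 * profileBetaIntegrand e σ τ a b x.1.1 x.1.2 x.2))
      (((volume.restrict (Ioi 0)).prod (volume.restrict (Ioi 0))).prod
        (volume.restrict (Ioo 0 1))) := by
    refine AEStronglyMeasurable.mul (Measurable.aestronglyMeasurable (by fun_prop)) (hA.mul ?_)
    unfold profileBetaIntegrand
    exact Measurable.aestronglyMeasurable (by fun_prop)
  rw [integrable_prod_iff' hm]
  constructor
  · filter_upwards [ae_restrict_mem measurableSet_Ioo] with t ht
    simp_rw [binomialSum_mul_profile_eq]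
    exact ((hr.integrableOn_comp_div (Real.rpow_pos_of_pos ht.1 σ)).mul_prod
      (hs.integrableOn_comp_div (Real.rpow_pos_of_pos (sub_pos.2 ht.2) τ))).const_mul _
  · refine (((integrableOn_binomialSum_mul η hz (integrableOn_beta ha hb)).norm).mul_const
      ((∫ p in Ioi (0 : ℝ), ‖(p : ℂ) ^ (r - 1) * e p‖) *
        ∫ q in Ioi (0 : ℝ), ‖(q : ℂ) ^ (s - 1) * e q‖)).congr ?_
    filter_upwards [ae_restrict_mem measurableSet_Ioo] with t ht
    have ht1 : 0 < 1 - t := sub_pos.2 ht.2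
    have hσ := Real.rpow_pos_of_pos ht.1 σ
    have hτ := Real.rpow_pos_of_pos ht1 τ
    simp_rw [binomialSum_mul_profile_eq]
    simp_rw [norm_mul (binomialSum η z t * _)]
    rw [integral_const_mul]
    simp_rw [norm_mul ((_ : ℂ) ^ (r - 1) * e _)]
    rw [integral_prod_mul (fun p : ℝ => ‖(p : ℂ) ^ (r - 1) * e (p / t ^ σ)‖)
      (fun q : ℝ => ‖(q : ℂ) ^ (s - 1) * e (q / (1 - t) ^ τ)‖),
      integral_norm_cpow_mul_comp_div hσ, integral_norm_cpow_mul_comp_div hτ,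
      ← ofReal_rpow_cpow_mul ht.1, ← Complex.ofReal_one, ← Complex.ofReal_sub, Complex.ofReal_one,
      ← ofReal_rpow_cpow_mul ht1]
    simp only [norm_mul, Complex.norm_cpow_eq_rpow_re_of_pos hσ,
      Complex.norm_cpow_eq_rpow_re_of_pos hτ]
    ring

theorem integrable_mellin_binomialSum_profile (he : Measurable e) (hr : HasMellin e r Mr)
    (hs : HasMellin e s Ms) (hz : ‖z‖ < 1) (ha : 0 < (a + σ * r).re) (hb : 0 < (b + τ * s).re) :
    Integrable (fun x : ℝ × ℝ => (x.1 : ℂ) ^ (r - 1) * (x.2 : ℂ) ^ (s - 1) *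
        ∫ t in Ioo (0 : ℝ) 1, binomialSum η z t * profileBetaIntegrand e σ τ a b x.1 x.2 t)
      ((volume.restrict (Ioi 0)).prod (volume.restrict (Ioi 0))) := by
  have := (integrable_binomialSum_mul_profile (η := η) he hr hs hz ha hb).integral_prod_left
  simpa only [integral_const_mul] using this

theorem integral_mellin_binomialSum_profile (he : Measurable e) (hr : HasMellin e r Mr)
    (hs : HasMellin e s Ms) (hz : ‖z‖ < 1) (ha : 0 < (a + σ * r).re) (hb : 0 < (b + τ * s).re) :
    ∫ x : ℝ × ℝ, (x.1 : ℂ) ^ (r - 1) * (x.2 : ℂ) ^ (s - 1) *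
        (∫ t in Ioo (0 : ℝ) 1, binomialSum η z t * profileBetaIntegrand e σ τ a b x.1 x.2 t)
      ∂((volume.restrict (Ioi 0)).prod (volume.restrict (Ioi 0))) =
    Mr * Ms * (Complex.betaIntegral (a + σ * r) (b + τ * s) *
      ordinaryHypergeometric η (a + σ * r) (a + σ * r + (b + τ * s)) z) := by
  simp_rw [← integral_const_mul]
  rw [integral_integral_swap (integrable_binomialSum_mul_profile (η := η) he hr hs hz ha hb),
    ← integral_binomialSum_mul_beta η hz ha hb, ← integral_const_mul]
  refine setIntegral_congr_fun measurableSet_Ioo fun t ht => ?_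
  have ht1 : 0 < 1 - t := sub_pos.2 ht.2
  simp_rw [binomialSum_mul_profile_eq]
  rw [integral_const_mul, integral_prod_mul (fun p : ℝ => (p : ℂ) ^ (r - 1) * e (p / t ^ σ))
      (fun q : ℝ => (q : ℂ) ^ (s - 1) * e (q / (1 - t) ^ τ)),
    hr.integral_comp_div (Real.rpow_pos_of_pos ht.1 σ),
    hs.integral_comp_div (Real.rpow_pos_of_pos ht1 τ), ← ofReal_rpow_cpow_mul ht.1,
    ← Complex.ofReal_one, ← Complex.ofReal_sub, Complex.ofReal_one, ← ofReal_rpow_cpow_mul ht1]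
  ring

end Fubini

/-! ### The Mittag-Leffler profile and the main theorem. -/

/-- The profile `x ↦ E_lam(-|x|)`. -/
noncomputable def mittagLefflerProfile (lam : ℝ) (x : ℝ) : ℂ :=
  mittagLeffler lam (-((|x| : ℝ) : ℂ))

/-- Evaluating at `|x|` keeps the argument on the half-line where measurability and the bound are
known, so both hold on all of `ℝ`. -/
theorem measurable_mittagLefflerProfile {lam : ℝ} (h0 : 0 < lam) :
    Measurable (mittagLefflerProfile lam) :=
  (measurable_mittagLeffler_neg h0).comp
    (Measurable.subtype_mk (h := fun x : ℝ => abs_nonneg x) measurable_abs)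

theorem mittagLefflerProfile_of_nonneg (lam : ℝ) {x : ℝ} (hx : 0 ≤ x) :
    mittagLefflerProfile lam x = mittagLeffler lam (-(x : ℂ)) := by
  rw [mittagLefflerProfile, abs_of_nonneg hx]

theorem hasMellin_mittagLefflerProfile {lam : ℝ} {w : ℂ} (h0 : 0 < lam) (hlam2 : lam < 2)
    (hw0 : 0 < w.re) (hsin : Complex.sin (Real.pi * w) ≠ 0) (hw1 : lam = 1 ∨ w.re < 1) :
    HasMellin (mittagLefflerProfile lam) w
      (Real.pi / (Complex.sin (Real.pi * w) * Complex.Gamma (1 - w * lam))) := by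
  have key : HasMellin (fun x : ℝ => mittagLeffler lam (-(x : ℂ))) w
      (Real.pi / (Complex.sin (Real.pi * w) * Complex.Gamma (1 - w * lam))) := by
    rcases hw1 with rfl | hw1
    · exact hasMellin_mittagLeffler_one_neg hw0 hsin
    · exact hasMellin_mittagLeffler_neg h0 hlam2 hw0 hw1
  have heq : EqOn (fun x : ℝ => (x : ℂ) ^ (w - 1) • mittagLeffler lam (-(x : ℂ)))
      (fun x : ℝ => (x : ℂ) ^ (w - 1) • mittagLefflerProfile lam x) (Ioi 0) := fun x hx => by
    simp only [mittagLefflerProfile_of_nonneg lam (le_of_lt hx)]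
  exact ⟨key.1.congr_fun heq measurableSet_Ioi,
    (setIntegral_congr_fun measurableSet_Ioi heq).symm.trans key.2⟩

theorem extBetaIntegrand_add_nat_eq (lam σ τ : ℝ) {p q t : ℝ} (hp : 0 ≤ p) (hq : 0 ≤ q)
    (a b : ℂ) (n : ℕ) (ht : t ∈ Ioo (0 : ℝ) 1) :
    extBetaIntegrand lam σ τ p q (a + n) b t =
      (t : ℂ) ^ n * profileBetaIntegrand (mittagLefflerProfile lam) σ τ a b p q t := by
  have ht1 : 0 < 1 - t := sub_pos.2 ht.2
  rw [extBetaIntegrand, profileBetaIntegrand, pow_mul_cpow_sub_one ht.1,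
    mittagLefflerProfile_of_nonneg lam (div_nonneg hp (Real.rpow_pos_of_pos ht.1 σ).le),
    mittagLefflerProfile_of_nonneg lam (div_nonneg hq (Real.rpow_pos_of_pos ht1 τ).le)]
  push_cast
  ring

theorem intervalIntegrable_extBetaIntegrand {lam σ τ : ℝ} (h0 : 0 < lam) (hlam2 : lam < 2)
    {p q : ℝ} (hp : 0 ≤ p) (hq : 0 ≤ q) {a b : ℂ} (ha : 0 < a.re) (hb : 0 < b.re) (n : ℕ) :
    IntervalIntegrable (extBetaIntegrand lam σ τ p q (a + n) b) volume 0 1 := by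
  obtain ⟨C, hC⟩ := exists_norm_mittagLeffler_neg_le h0 hlam2
  rw [intervalIntegrable_iff_integrableOn_Ioo_of_le zero_le_one]
  exact (integrableOn_pow_mul (integrableOn_profileBetaIntegrand
    (measurable_mittagLefflerProfile h0) (fun x => hC |x| (abs_nonneg x)) σ τ ha hb p q) n).congr_fun
    (fun t ht => (extBetaIntegrand_add_nat_eq lam σ τ hp hq a b n ht).symm) measurableSet_Ioo

theorem hasSum_extHypergeometricTerm {lam σ τ : ℝ} (h0 : 0 < lam) (hlam2 : lam < 2)
    {p q : ℝ} (hp : 0 ≤ p) (hq : 0 ≤ q) (η₁ : ℂ) {η₂ η₃ z : ℂ} (ha : 0 < η₂.re)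
    (hb : 0 < (η₃ - η₂).re) (hz : ‖z‖ < 1) :
    HasSum (extHypergeometricTerm lam σ τ p q η₁ η₂ η₃ z)
      ((∫ t in Ioo (0 : ℝ) 1, binomialSum η₁ z t *
        profileBetaIntegrand (mittagLefflerProfile lam) σ τ η₂ (η₃ - η₂) p q t) /
          Complex.betaIntegral η₂ (η₃ - η₂)) := by
  obtain ⟨C, hC⟩ := exists_norm_mittagLeffler_neg_le h0 hlam2
  have h := (hasSum_binomialCoeff_mul_integral η₁ hz (integrableOn_profileBetaIntegrand
    (measurable_mittagLefflerProfile h0) (fun x => hC |x| (abs_nonneg x)) σ τ ha hb p q)).div_const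
    (Complex.betaIntegral η₂ (η₃ - η₂))
  refine Eq.mpr (congrArg (fun f : ℕ → ℂ => HasSum f _) (funext fun n => ?_)) h
  rw [extHypergeometricTerm, extBeta, intervalIntegral.integral_of_le zero_le_one,
    integral_Ioc_eq_integral_Ioo, setIntegral_congr_fun measurableSet_Ioo fun t ht =>
      extBetaIntegrand_add_nat_eq lam σ τ hp hq η₂ (η₃ - η₂) n ht, binomialCoeff]
  ring

theorem mainTheorem5 (lam σ τ : ℝ) (η₁ η₂ η₃ z r s : ℂ)
    (hlam : 0 < lam) (hlam2 : lam < 2) (hσ : 0 < σ) (hτ : 0 < τ)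
    (hη₂ : 0 < η₂.re) (hη₃ : η₂.re < η₃.re) (hz : ‖z‖ < 1)
    (hr : 0 < r.re) (hs : 0 < s.re)
    (hsinr : Complex.sin (Real.pi * r) ≠ 0) (hsins : Complex.sin (Real.pi * s) ≠ 0)
    (hstrip : lam = 1 ∨ (r.re < 1 ∧ s.re < 1)) :
    (∀ p q : ℝ, 0 ≤ p → 0 ≤ q →
      (∀ n : ℕ, IntervalIntegrable
        (extBetaIntegrand lam σ τ p q (η₂ + n) (η₃ - η₂)) volume 0 1) ∧
      Summable (extHypergeometricTerm lam σ τ p q η₁ η₂ η₃ z)) ∧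
    DoubleMellinConvergent (fun p q => extHypergeometric lam σ τ p q η₁ η₂ η₃ z) r s ∧
    doubleMellin (fun p q => extHypergeometric lam σ τ p q η₁ η₂ η₃ z) r s =
      (Real.pi : ℂ) ^ 2
          / (Complex.sin (Real.pi * r) * Complex.sin (Real.pi * s)
              * Complex.Gamma (1 - r * lam) * Complex.Gamma (1 - s * lam))
        * (Complex.betaIntegral (η₂ + σ * r) (η₃ + τ * s - η₂)
            / Complex.betaIntegral η₂ (η₃ - η₂))
        * ordinaryHypergeometric η₁ (η₂ + σ * r) (η₃ + σ * r + τ * s) z := by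
  have hb : 0 < (η₃ - η₂).re := by simpa using hη₃
  have ha' : 0 < (η₂ + σ * r).re := by simpa using add_pos hη₂ (mul_pos hσ hr)
  have hb' : 0 < (η₃ - η₂ + τ * s).re := by
    rw [Complex.add_re, Complex.re_ofReal_mul]
    exact add_pos hb (mul_pos hτ hs)
  have hMr := hasMellin_mittagLefflerProfile hlam hlam2 hr hsinr (hstrip.imp_right And.left)
  have hMs := hasMellin_mittagLefflerProfile hlam hlam2 hs hsins (hstrip.imp_right And.right)
  have he := measurable_mittagLefflerProfile hlam
  have hI := (integrable_mellin_binomialSum_profile (η := η₁) he hMr hMs hz ha' hb').mul_const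
    (Complex.betaIntegral η₂ (η₃ - η₂))⁻¹
  have heq : EqOn (fun x : ℝ × ℝ => (x.1 : ℂ) ^ (r - 1) * (x.2 : ℂ) ^ (s - 1) *
      (∫ t in Ioo (0 : ℝ) 1, binomialSum η₁ z t *
        profileBetaIntegrand (mittagLefflerProfile lam) σ τ η₂ (η₃ - η₂) x.1 x.2 t) *
          (Complex.betaIntegral η₂ (η₃ - η₂))⁻¹)
      (fun x : ℝ × ℝ => (x.1 : ℂ) ^ (r - 1) * (x.2 : ℂ) ^ (s - 1) *
        extHypergeometric lam σ τ x.1 x.2 η₁ η₂ η₃ z) (Ioi 0 ×ˢ Ioi 0) := fun x hx => by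
    simp only [extHypergeometric]
    rw [(hasSum_extHypergeometricTerm hlam hlam2 (le_of_lt hx.1) (le_of_lt hx.2) η₁ hη₂ hb
      hz).tsum_eq, mul_div_assoc', div_eq_mul_inv]
  have hms : MeasurableSet (Ioi (0 : ℝ) ×ˢ Ioi (0 : ℝ)) := measurableSet_Ioi.prod measurableSet_Ioi
  have hconv : DoubleMellinConvergent
      (fun p q => extHypergeometric lam σ τ p q η₁ η₂ η₃ z) r s := by
    rw [Measure.prod_restrict] at hI
    exact IntegrableOn.congr_fun hI heq hms
  refine ⟨fun p q hp hq => ⟨fun n => intervalIntegrable_extBetaIntegrand hlam hlam2 hp hq hη₂ hb n,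
    (hasSum_extHypergeometricTerm hlam hlam2 hp hq η₁ hη₂ hb hz).summable⟩, hconv, ?_⟩
  have hconv' := hconv
  rw [DoubleMellinConvergent, IntegrableOn, Measure.volume_eq_prod, ← Measure.prod_restrict]
    at hconv'
  -- The symmetric form of Fubini fits the order of the iterated integral: `p` inside, `q` outside.
  rw [doubleMellin, ← integral_prod_symm _ hconv', Measure.prod_restrict,
    ← setIntegral_congr_fun hms heq, ← Measure.prod_restrict, integral_mul_const,
    integral_mellin_binomialSum_profile (η := η₁) he hMr hMs hz ha' hb',
    show η₃ - η₂ + τ * s = η₃ + τ * s - η₂ by ring,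
    show η₂ + σ * r + (η₃ + τ * s - η₂) = η₃ + σ * r + τ * s by ring]
  ring
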